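/- Let $(a_n)_{n\ge 0}$ be a sequence of complex numbers (for example real), let $p\ge 1$ be an integer, and put $f_n=n^p a_n$. Say that a sequence $(g_n)_{n\ge0}$ satisfies the $L^2$-Hausdorff condition if there is $M>0$ with $$(n+1)\sum_{i=0}^n\binom{n}{i}^2\,|\Delta^i g_{n-i}|^2<M\qquad(n=0,1,2,\dots),\qquad \Delta g_n=g_{n+1}-g_n .$$ Suppose that $(f_n)$ satisfies the $L^2$-Hausdorff condition. Then: 1. The series $\frac1{2\pi}\sum_{n=0}^\infty a_n e^{-in\theta}$ converges uniformly in the half-plane $\operatorname{Im}\theta<0$ to a function $f(\theta)$ analytic there. 2. $f$ extends holomorphically to the cut upper half-plane $\{\operatorname{Im}\theta>0\}\setminus\{2k\pi+iv: k\in\mathbb Z,\ v>0\}$, across $\mathbb R\setminus 2\pi\mathbb Z$; that is, $f$ extends to a holomorphic function on $\mathbb C\setminus\{2k\pi+iv: k\in\mathbb Z,\ v\ge 0\}$. 3. At each point $2k\pi+iv$ ($k\in\mathbb Z$, $v>0$) of the cuts the extension has boundary values $f_+$ and $f_-$ from the right and from the left, and the jump $F(v)=i\,(f_+-f_-)$ does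 not depend on $k$ and is a function of class $C^{p-1}$ on $(0,\infty)$. Suppose moreover that the sequence $(a_n)$ itself satisfies the $L^2$-Hausdorff condition. Then $(a_n)$ has a Carlson interpolant $\tilde a$, that is, a function in the Hardy space $H^2$ of the half-plane $\operatorname{Re}\lambda>-\tfrac12$ with $\tilde a(n)=a_n$ for all $n\ge0$; it is unique (on the line $\operatorname{Re}\lambda=-\frac12$, $\tilde a$ denotes the $L^2$ boundary values, defined almost everywhere). Moreover: 4. For every $\sigma\ge-\frac12$ the function $\nu\mapsto\tilde a(\sigma+i\nu)$ is integrable on $\mathbb R$ and $$|F(v)|\le\|\tilde a_\sigma\|_1\,e^{\sigma v}\quad(v>0),\qquad \|\tilde a_\sigma\|_1=\frac1{2\pi}\int_{-\infty}^{+\infty}|\tilde a(\sigma+i\nu)|\,d\nu .$$ 5. $\tilde a$ is the Laplace transform of the jump: for $\sigma>-\frac12$ and $\nu\in\mathbb R$, $$\tilde a(\sigma+i\nu)=\int_0^{+\infty}F(v)\,e^{-(\sigma+i\nu)v}\,dv ,$$ the integral being absolutely convergent. 6. For every $\sigma\ge-\frac12$ the Plancherel equality holds, both sides being finite: $$\int_{-\infty}^{+\infty}|\tilde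 a(\sigma+i\nu)|^2\,d\nu=2\pi\int_0^{+\infty}|F(v)\,e^{-\sigma v}|^2\,dv .$$ -/

import Mathlib

open Set Filter Topology MeasureTheory

/-- The `L²` Hausdorff moment condition: for some `M > 0` and all `n`,
`(n+1) ∑_{i=0}^n (n choose i)² |Δ^i f_{n-i}|² < M`, where `Δ f_n = f_{n+1} - f_n`. -/
def L2HausdorffCondition (f : ℕ → ℂ) : Prop :=
  ∃ M : ℝ, 0 < M ∧ ∀ n : ℕ,
    ((n : ℝ) + 1) *
      ∑ i ∈ Finset.range (n + 1), (n.choose i : ℝ) ^ 2 * ‖(fwdDiff 1)^[i] f (n - i)‖ ^ 2 < M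

/-- The point `σ + iν`. -/
noncomputable def verticalPoint (σ ν : ℝ) : ℂ := (σ : ℂ) + (ν : ℂ) * Complex.I

/-- `g` is in the Hardy space `H²` of the half-plane `Re λ > -1/2`: it is holomorphic there and the
integrals of `|g|²` over the vertical lines in the half-plane are bounded. The values of `g` on the
boundary line `Re λ = -1/2` are the usual boundary values, the limits in the `L²` norm (this
determines them up to a null set). -/
structure IsHardyTwo (g : ℂ → ℂ) : Prop where
  holomorphic : DifferentiableOn ℂ g {z : ℂ | -(1 / 2 : ℝ) < z.re}
  bounded : ∃ C : NNReal, ∀ σ : ℝ, -(1 / 2 : ℝ) < σ →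
    eLpNorm (fun ν : ℝ => g (verticalPoint σ ν)) 2 volume ≤ C
  boundary_memLp : MemLp (fun ν : ℝ => g (verticalPoint (-(1 / 2)) ν)) 2 volume
  boundary_tendsto : Tendsto
    (fun σ : ℝ => eLpNorm
      (fun ν : ℝ => g (verticalPoint σ ν) - g (verticalPoint (-(1 / 2)) ν)) 2 volume)
    (𝓝[>] (-(1 / 2 : ℝ))) (𝓝 0)

/-- `b` is a Carlson interpolant of the sequence `a`: a function of the Hardy space `H²` of
`Re λ > -1/2` with `b n = a n` for all `n ≥ 0`. -/
structure IsCarlsonInterpolant (a : ℕ → ℂ) (b : ℂ → ℂ) : Prop where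
  hardy : IsHardyTwo b
  interpolates : ∀ n : ℕ, b (n : ℂ) = a n

/-- The open lower half-plane. -/
def lowerHalfPlane : Set ℂ := {θ : ℂ | θ.im < 0}

/-- The plane slit along the vertical half-lines `2kπ + iv`, `v ≥ 0`, `k ∈ ℤ`: the union of the
lower half-plane, of the upper half-plane without the cuts, and of the points of the real axis that
are not multiples of `2π`, through which the two are joined. -/
def cutDomain : Set ℂ := {θ : ℂ | ¬ ∃ k : ℤ, θ.re = 2 * (k : ℝ) * Real.pi ∧ 0 ≤ θ.im}

/-- `F v` is the discontinuity `i (f₊ - f₋)` of `i f` at the point `2kπ + iv`, `v > 0`, of each of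
the cuts, where `f₊` and `f₋` are the limits of `f` from the right and from the left of the cut. -/
def IsJumpAcrossCuts (f : ℂ → ℂ) (F : ℝ → ℂ) : Prop :=
  ∀ k : ℤ, ∀ v : ℝ, 0 < v → ∃ fp fm : ℂ,
    Tendsto f (𝓝[{θ : ℂ | 2 * (k : ℝ) * Real.pi < θ.re}]
      (verticalPoint (2 * (k : ℝ) * Real.pi) v)) (𝓝 fp) ∧
    Tendsto f (𝓝[{θ : ℂ | θ.re < 2 * (k : ℝ) * Real.pi}]
      (verticalPoint (2 * (k : ℝ) * Real.pi) v)) (𝓝 fm) ∧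
    F v = Complex.I * (fp - fm)

open scoped FourierTransform SchwartzMap ENNReal ContDiff

/-! The `L²` condition on `f n = n ^ p * a n` is a moment condition: it produces a density `G` on
`(0, ∞)`, with `G v * exp (v / 2)` square integrable, whose Laplace transform takes the value `f n`
at every `n`. To see this, write a finite combination of the `f j` through the differences at level
`n`, apply Cauchy–Schwarz, and let `n → ∞`. The binomial ratios that appear become powers of `1 -
x`, so the functional sending `∑ c j x ^ j` to `∑ c j f j` is bounded on `L²(0, 1)`. Riesz
representation and the substitution `x = exp (-v)` give `G`.

Division by `n ^ p` is `p`-fold integration on the Laplace side. If `F` is the `p`-fold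
antiderivative of `G` from `0`, then `s ^ p * LF s = LG s` for `Re s > 0`, hence `a n = LF n` for `n
≥ 1`. Integration also supplies the regularity: the first antiderivative is continuous, even Hölder
of exponent `1/2`, and each further one gains a derivative, so `F` is `C^(p-1)`.

With `φ x = F (-log x)` on `(0, 1)` and `ζ = exp (iθ)`, the terms `n ≥ 1` of the series are the
geometric expansion of the Cauchy integral `∫ φ x / (ζ - x) dx`. This integral is holomorphic off
`[0, 1]`, whose preimage under `exp (iθ)` consists of the cuts. The Plemelj formula gives its jump,
proportional to `φ`, and the normalisation `1 / 2π` makes the jump of the series equal to `F` on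
every cut.

If `a` satisfies the condition too, it has a density `A` of its own. `F` and `A` have the same
Laplace transform at all positive integers, so Carlson's theorem (a bounded holomorphic function on
a half-plane vanishing at the positive integers is zero, by Blaschke factors and the divergent
harmonic series) gives `F = A` almost everywhere. Thus `F` has the weighted bound down to `σ =
-1/2`, and `LF`, completed by its `L²` boundary values, is an interpolant. Any other one is bounded
for `Re s > 0` by the mean value property, so Carlson's theorem makes it equal to `LF`. Plancherel
on vertical lines is Plancherel for `F v * exp (-σ v)`. Integrability on these lines holds because
both `LF` and `s ^ p * LF = LG` are square integrable there; the exponential bound is then Fourier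
inversion. -/

/-! ### The Hausdorff moment problem in `L²` -/

/-- Binomial expansion of `1 = (E - Δ) ^ m`, where the shift `E` commutes with `Δ`. -/
theorem eq_sum_choose_mul_fwdDiff_iter (f : ℕ → ℂ) (m j : ℕ) :
    f j = ∑ i ∈ Finset.range (m + 1),
      (m.choose i : ℂ) * ((-1) ^ i * (fwdDiff 1)^[i] f (j + m - i)) := by
  have hc : Commute (-(fwdDiff_aux.fwdDiffₗ ℕ ℂ 1)) (fwdDiff_aux.shiftₗ ℕ ℂ 1) :=
    ((Commute.refl _).add_right (Commute.one_right _)).neg_left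
  have h2 := hc.add_pow m
  have h3 : -(fwdDiff_aux.fwdDiffₗ ℕ ℂ 1) + fwdDiff_aux.shiftₗ ℕ ℂ 1 = 1 := by
    rw [fwdDiff_aux.shiftₗ]; abel
  rw [h3, one_pow] at h2
  have h4 := congrFun (congrArg (fun T : Module.End ℤ (ℕ → ℂ) => T f) h2) j
  simp only [Module.End.one_apply, LinearMap.sum_apply, Finset.sum_apply] at h4
  rw [h4]
  refine Finset.sum_congr rfl fun i hi => ?_
  have hi' : i ≤ m := Nat.lt_succ_iff.mp (Finset.mem_range.mp hi)
  have h5 : (m.choose i : Module.End ℤ (ℕ → ℂ)) f = (m.choose i : ℂ) • f := by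
    ext; simp [Module.End.natCast_apply]
  have h6 : (-(fwdDiff_aux.fwdDiffₗ ℕ ℂ 1)) ^ i =
      ((-1) ^ i : ℤ) • (fwdDiff_aux.fwdDiffₗ ℕ ℂ 1) ^ i := by
    rw [neg_pow, zsmul_eq_mul]; simp
  have h7 : (fwdDiff_aux.shiftₗ ℕ ℂ 1 ^ (m - i)) f = fun y => f (y + (m - i)) := by
    ext y; rw [fwdDiff_aux.shiftₗ_pow_apply]; simp
  rw [(Nat.cast_commute _ _).symm.eq, Module.End.mul_apply, Module.End.mul_apply, h7, h6,
    LinearMap.smul_apply, Module.End.natCast_apply, fwdDiff_aux.coe_fwdDiffₗ_pow]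
  simp only [Pi.smul_apply, nsmul_eq_mul, zsmul_eq_mul]
  have h8 : (fwdDiff 1)^[i] (fun y => f (y + (m - i))) j = (fwdDiff 1)^[i] f (j + (m - i)) :=
    fwdDiff_iter_comp_add 1 f (m - i) i j
  simp only [Pi.mul_apply, Pi.intCast_apply]
  rw [h8, Nat.add_sub_assoc hi']
  push_cast
  rfl

/-- The ratio is a product of `j` factors `(n - l - i) / (n - l)`, `l < j`, and each tends to `1 -
x` when `i / n → x`. The induction on `j` adds one factor at a time. -/
theorem tendsto_choose_div_choose (x : ℝ) (hx : x ∈ Ioo (0 : ℝ) 1) (j : ℕ) :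
    Tendsto (fun n : ℕ => ((n - j).choose ⌊((n : ℝ) + 1) * x⌋₊ : ℝ) / n.choose ⌊((n : ℝ) + 1) * x⌋₊)
      atTop (𝓝 ((1 - x) ^ j)) := by
  have hfl : Tendsto (fun n : ℕ => (⌊((n : ℝ) + 1) * x⌋₊ : ℝ) / n) atTop (𝓝 x) := by
    have h1 : Tendsto (fun n : ℕ => (⌊x * ((n : ℝ) + 1)⌋₊ : ℝ) / ((n : ℝ) + 1)) atTop (𝓝 x) :=
      (tendsto_nat_floor_mul_div_atTop hx.1.le).comp
        (tendsto_atTop_add_const_right _ _ tendsto_natCast_atTop_atTop)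
    have h2 : Tendsto (fun n : ℕ => ((n : ℝ) + 1) / n) atTop (𝓝 1) := by
      have := (tendsto_one_div_atTop_nhds_zero_nat (𝕜 := ℝ)).const_add 1
      rw [add_zero] at this
      refine this.congr' ?_
      filter_upwards [eventually_gt_atTop 0] with n hn
      field_simp
    have h3 := h1.mul h2
    rw [mul_one] at h3
    refine h3.congr' ?_
    filter_upwards [eventually_gt_atTop 0] with n hn
    rw [mul_comm x]
    field_simp
  induction j with
  | zero =>
    refine tendsto_const_nhds.congr' ?_
    have h1 := hfl.eventually (gt_mem_nhds hx.2)
    filter_upwards [h1, eventually_gt_atTop 0] with n hn hn0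
    have : ⌊((n : ℝ) + 1) * x⌋₊ ≤ n := by
      rw [div_lt_one (by exact_mod_cast hn0)] at hn
      exact_mod_cast hn.le
    have h0 := Nat.choose_pos this
    simp only [tsub_zero, pow_zero]
    rw [div_self (by positivity)]
  | succ j ih =>
    have h1 : Tendsto (fun n : ℕ => ((n : ℝ) - j - ⌊((n : ℝ) + 1) * x⌋₊) / (n - j)) atTop
        (𝓝 (1 - x)) := by
      have hj : Tendsto (fun n : ℕ => (j : ℝ) / n) atTop (𝓝 0) :=
        tendsto_const_div_atTop_nhds_zero_nat (j : ℝ)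
      have := ((hj.const_sub 1).sub hfl).div (hj.const_sub 1) (by simp)
      simp only [sub_zero, div_one] at this
      refine this.congr' ?_
      filter_upwards [eventually_gt_atTop j] with n hn
      have : (0 : ℝ) < n := by exact_mod_cast (Nat.zero_le j).trans_lt hn
      have h2 : (0 : ℝ) < n - j := by rw [sub_pos]; exact_mod_cast hn
      have h3 : (0 : ℝ) < 1 - j / n := by
        rw [sub_pos, div_lt_one this]; exact_mod_cast hn
      simp only [Pi.div_apply]
      rw [div_eq_div_iff h3.ne' h2.ne']
      field_simp
    have h2 := ih.mul h1
    rw [← pow_succ] at h2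
    refine h2.congr' ?_
    have hlt : ∀ᶠ n : ℕ in atTop, ((⌊((n : ℝ) + 1) * x⌋₊ : ℝ) + j) / n < 1 := by
      have hj : Tendsto (fun n : ℕ => (j : ℝ) / n) atTop (𝓝 0) :=
        tendsto_const_div_atTop_nhds_zero_nat (j : ℝ)
      have := hfl.add hj
      rw [add_zero] at this
      filter_upwards [this.eventually (gt_mem_nhds hx.2)] with n hn
      rwa [add_div]
    filter_upwards [eventually_gt_atTop j, hlt] with n hn hn2
    set i := ⌊((n : ℝ) + 1) * x⌋₊
    have hn0 : (0 : ℝ) < n := by exact_mod_cast (Nat.zero_le j).trans_lt hn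
    have hi : i + j < n := by
      rw [div_lt_one hn0] at hn2; exact_mod_cast hn2
    obtain ⟨m, rfl⟩ : ∃ m, n = m + 1 + j := ⟨n - 1 - j, by omega⟩
    have e1 : m + 1 + j - (j + 1) = m := by omega
    have e2 : m + 1 + j - j = m + 1 := by omega
    rw [e1, e2]
    have h := Nat.choose_mul_succ_eq m i
    have h' : (m.choose i : ℝ) * (m + 1) = (m + 1).choose i * ((m : ℝ) + 1 - i) := by
      have : ((m + 1 - i : ℕ) : ℝ) = (m : ℝ) + 1 - i := by
        rw [Nat.cast_sub (by omega)]; push_cast; ring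
      rw [← this]; exact_mod_cast h
    push_cast
    have h5 : ((m : ℝ) + 1 + j - j) = m + 1 := by ring
    rw [h5]
    have : (0 : ℝ) < m + 1 := by positivity
    rw [div_mul_div_comm, ← h']
    field_simp

theorem integral_natFloor_mul (h : ℕ → ℝ) (N : ℕ) (hN : 0 < N) :
    ∫ x in (0 : ℝ)..1, h ⌊(N : ℝ) * x⌋₊ = (1 / N) * ∑ k ∈ Finset.range N, h k := by
  have hN' : (0 : ℝ) < N := by exact_mod_cast hN
  have hcell : ∀ k : ℕ, EqOn (fun x : ℝ => h ⌊(N : ℝ) * x⌋₊) (fun _ => h k)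
      (Ioo ((k : ℝ) / N) (((k + 1 : ℕ) : ℝ) / N)) := by
    intro k x hx
    have : ⌊(N : ℝ) * x⌋₊ = k := by
      have h1 := (div_lt_iff₀ hN').mp hx.1
      have h2 := (lt_div_iff₀ hN').mp hx.2
      push_cast at h2
      rw [Nat.floor_eq_iff (by nlinarith [Nat.cast_nonneg (α := ℝ) k])]
      constructor <;> linarith
    simp only [this]
  have hle : ∀ k : ℕ, (k : ℝ) / N ≤ ((k + 1 : ℕ) : ℝ) / N := fun k => by
    gcongr; simp
  have hint : ∀ k < N, IntervalIntegrable (fun x : ℝ => h ⌊(N : ℝ) * x⌋₊) volume ((k : ℝ) / N)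
      (((k + 1 : ℕ) : ℝ) / N) := fun k _ => by
    rw [intervalIntegrable_iff_integrableOn_Ioo_of_le (hle k)]
    exact (integrableOn_const (by simp)).congr_fun (hcell k).symm measurableSet_Ioo
  have := intervalIntegral.sum_integral_adjacent_intervals (a := fun k : ℕ => (k : ℝ) / N) hint
  simp only [Nat.cast_zero, zero_div, div_self hN'.ne'] at this
  rw [← this, Finset.mul_sum]
  refine Finset.sum_congr rfl fun k _ => ?_
  rw [intervalIntegral.integral_congr_Ioo_of_le (hle k) (hcell k), intervalIntegral.integral_const]
  simp only [smul_eq_mul]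
  congr 1
  push_cast
  ring

/-- The bound makes the functional `∑ c j e j ↦ ∑ c j f j` well defined and continuous on the span
of the `e j`, even when they are linearly dependent. Hahn–Banach extends it and Riesz represents it.
-/
theorem exists_inner_eq_of_bounded {H : Type*} [NormedAddCommGroup H] [InnerProductSpace ℂ H]
    [CompleteSpace H] (e : ℕ → H) (f : ℕ → ℂ) (C : ℝ)
    (hC : ∀ c : ℕ →₀ ℂ, ‖Finsupp.linearCombination ℂ f c‖ ≤ C * ‖Finsupp.linearCombination ℂ e c‖) :
    ∃ h : H, ∀ j, inner ℂ h (e j) = f j := by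
  set T := Finsupp.linearCombination ℂ e
  set L := Finsupp.linearCombination ℂ f
  have hker : LinearMap.ker T ≤ LinearMap.ker L := fun c hc => by
    have := hC c
    rw [LinearMap.mem_ker] at hc ⊢
    rw [hc, norm_zero, mul_zero] at this
    exact norm_le_zero_iff.mp this
  set φ : LinearMap.range T →ₗ[ℂ] ℂ :=
    ((LinearMap.ker T).liftQ L hker) ∘ₗ T.quotKerEquivRange.symm.toLinearMap
  have hφ : ∀ c, φ ⟨T c, LinearMap.mem_range_self T c⟩ = L c := fun c => by
    have : T.quotKerEquivRange.symm ⟨T c, LinearMap.mem_range_self T c⟩ =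
        (LinearMap.ker T).mkQ c := by
      rw [LinearEquiv.symm_apply_eq]; rfl
    simp only [φ, LinearMap.comp_apply, LinearEquiv.coe_coe, this]
    simp
  have hb : ∀ x, ‖φ x‖ ≤ C * ‖x‖ := by
    rintro ⟨_, c, rfl⟩
    rw [hφ]
    exact hC c
  obtain ⟨g, hg, -⟩ := exists_extension_norm_eq (LinearMap.range T) (φ.mkContinuous C hb)
  refine ⟨(InnerProductSpace.toDual ℂ H).symm g, fun j => ?_⟩
  rw [InnerProductSpace.toDual_symm_apply]
  have := hg ⟨T (Finsupp.single j 1), LinearMap.mem_range_self T _⟩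
  rw [LinearMap.mkContinuous_apply, hφ] at this
  simpa [T, L] using this

theorem image_exp_neg_Ioi : (fun v : ℝ => Real.exp (-v)) '' Ioi 0 = Ioo 0 1 := by
  ext x
  constructor
  · rintro ⟨v, hv, rfl⟩
    exact ⟨Real.exp_pos _, by simpa using hv⟩
  · intro hx
    exact ⟨-Real.log x, by simpa using Real.log_neg hx.1 hx.2, by simp [Real.exp_log hx.1]⟩

theorem hasDerivWithinAt_exp_neg (s : Set ℝ) (v : ℝ) :
    HasDerivWithinAt (fun v : ℝ => Real.exp (-v)) (-Real.exp (-v)) s v := by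
  simpa using ((hasDerivAt_neg v).exp).hasDerivWithinAt

theorem injOn_exp_neg (s : Set ℝ) : InjOn (fun v : ℝ => Real.exp (-v)) s := fun x _ y _ h => by
  simpa using h

theorem integral_Ioo_eq_integral_exp_neg {E : Type*} [NormedAddCommGroup E] [NormedSpace ℝ E]
    (φ : ℝ → E) :
    ∫ x in Ioo (0 : ℝ) 1, φ x = ∫ v in Ioi (0 : ℝ), Real.exp (-v) • φ (Real.exp (-v)) := by
  rw [← image_exp_neg_Ioi, integral_image_eq_integral_abs_deriv_smul measurableSet_Ioi
    (fun v _ => hasDerivWithinAt_exp_neg _ v) (injOn_exp_neg _)]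
  simp [abs_of_pos (Real.exp_pos _)]

theorem integrableOn_Ioo_iff_exp_neg {E : Type*} [NormedAddCommGroup E] [NormedSpace ℝ E]
    (φ : ℝ → E) :
    IntegrableOn φ (Ioo 0 1) ↔
      IntegrableOn (fun v : ℝ => Real.exp (-v) • φ (Real.exp (-v))) (Ioi 0) := by
  rw [← image_exp_neg_Ioi, integrableOn_image_iff_integrableOn_abs_deriv_smul measurableSet_Ioi
    (fun v _ => hasDerivWithinAt_exp_neg _ v) (injOn_exp_neg _)]
  simp [abs_of_pos (Real.exp_pos _)]

/-- Every `f j` is expanded in the differences of the same level `n`, with `m = n - j`. The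
differences, weighted by `n.choose i`, are controlled by the hypothesis, and Cauchy–Schwarz leaves
the sum of the squared ratios, a Riemann sum written as the integral of a step function. -/
theorem norm_sq_sum_mul_le (f : ℕ → ℂ) (M : ℝ)
    (hM : ∀ n : ℕ, ((n : ℝ) + 1) *
      ∑ i ∈ Finset.range (n + 1), (n.choose i : ℝ) ^ 2 * ‖(fwdDiff 1)^[i] f (n - i)‖ ^ 2 < M)
    (c : ℕ → ℂ) (N : ℕ) (n : ℕ) (hn : N ≤ n) :
    ‖∑ j ∈ Finset.range N, c j * f j‖ ^ 2 ≤ M * ∫ x in (0 : ℝ)..1,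
      ‖∑ j ∈ Finset.range N, c j * (((n - j).choose ⌊((n : ℝ) + 1) * x⌋₊ : ℝ) /
        n.choose ⌊((n : ℝ) + 1) * x⌋₊ : ℝ)‖ ^ 2 := by
  have hint := integral_natFloor_mul (fun i => ‖∑ j ∈ Finset.range N,
    c j * (((n - j).choose i : ℝ) / n.choose i : ℝ)‖ ^ 2) (n + 1) n.succ_pos
  push_cast at hint ⊢
  rw [hint]
  set w : ℕ → ℂ := fun i => ∑ j ∈ Finset.range N, c j * (((n - j).choose i : ℂ) / n.choose i)
  set d : ℕ → ℂ := fun i => (n.choose i : ℂ) * ((-1) ^ i * (fwdDiff 1)^[i] f (n - i))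
  have key : ∑ j ∈ Finset.range N, c j * f j = ∑ i ∈ Finset.range (n + 1), w i * d i := by
    simp only [w, Finset.sum_mul]
    rw [Finset.sum_comm]
    refine Finset.sum_congr rfl fun j hj => ?_
    have hjn : j ≤ n := (Finset.mem_range.mp hj).le.trans hn
    -- For `i > n - j` the binomial coefficient vanishes, so all `j` can share the range of `i`.
    have h1 : ∑ i ∈ Finset.range (n + 1), c j * (((n - j).choose i : ℂ) / n.choose i) * d i =
        ∑ i ∈ Finset.range (n - j + 1), c j * (((n - j).choose i : ℂ) / n.choose i) * d i := by
      symm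
      refine Finset.sum_subset (Finset.range_mono (by omega)) fun i _ hi => ?_
      rw [Nat.choose_eq_zero_of_lt (by simpa using hi)]
      simp
    rw [h1, eq_sum_choose_mul_fwdDiff_iter f (n - j) j, Finset.mul_sum]
    refine Finset.sum_congr rfl fun i hi => ?_
    have hi' : i ≤ n := by have := Finset.mem_range.mp hi; omega
    have hne : (n.choose i : ℂ) ≠ 0 := by exact_mod_cast (Nat.choose_pos hi').ne'
    simp only [d]
    rw [show j + (n - j) = n by omega]
    field_simp
  have hcs : ‖∑ i ∈ Finset.range (n + 1), w i * d i‖ ^ 2 ≤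
      (∑ i ∈ Finset.range (n + 1), ‖w i‖ ^ 2) * ∑ i ∈ Finset.range (n + 1), ‖d i‖ ^ 2 := by
    refine le_trans ?_ (Finset.sum_mul_sq_le_sq_mul_sq _ _ _)
    gcongr
    refine (norm_sum_le _ _).trans_eq (by simp)
  have hd : ∑ i ∈ Finset.range (n + 1), ‖d i‖ ^ 2 ≤ M / (n + 1) := by
    rw [le_div_iff₀ (by positivity), mul_comm]
    refine le_trans (le_of_eq ?_) (hM n).le
    congr 1
    refine Finset.sum_congr rfl fun i _ => ?_
    simp [d, mul_pow]
  rw [key]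
  refine hcs.trans ((mul_le_mul_of_nonneg_left hd (Finset.sum_nonneg fun _ _ => by positivity)).trans
    (le_of_eq ?_))
  change _ = M * (1 / ((n : ℝ) + 1) * ∑ i ∈ Finset.range (n + 1), ‖w i‖ ^ 2)
  ring

theorem norm_sq_sum_mul_le_integral (f : ℕ → ℂ) (M : ℝ)
    (hM : ∀ n : ℕ, ((n : ℝ) + 1) *
      ∑ i ∈ Finset.range (n + 1), (n.choose i : ℝ) ^ 2 * ‖(fwdDiff 1)^[i] f (n - i)‖ ^ 2 < M)
    (c : ℕ → ℂ) (N : ℕ) :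
    ‖∑ j ∈ Finset.range N, c j * f j‖ ^ 2 ≤ M * ∫ x in (0 : ℝ)..1,
      ‖∑ j ∈ Finset.range N, c j * ((x ^ j : ℝ) : ℂ)‖ ^ 2 := by
  -- The limit of the step functions produces powers of `1 - x`; the reflection of `[0, 1]` turns
  -- them into powers of `x`.
  have hrefl : ∫ x in (0 : ℝ)..1, ‖∑ j ∈ Finset.range N, c j * ((x ^ j : ℝ) : ℂ)‖ ^ 2 =
      ∫ x in (0 : ℝ)..1, ‖∑ j ∈ Finset.range N, c j * (((1 - x) ^ j : ℝ) : ℂ)‖ ^ 2 := by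
    have := intervalIntegral.integral_comp_sub_left
      (fun x : ℝ => ‖∑ j ∈ Finset.range N, c j * ((x ^ j : ℝ) : ℂ)‖ ^ 2) (a := 0) (b := 1) 1
    simpa using this.symm
  rw [hrefl]
  have hw : ∀ n j i : ℕ, |(((n - j).choose i : ℝ) / n.choose i)| ≤ 1 := fun n j i => by
    rw [abs_of_nonneg (by positivity)]
    refine div_le_one_of_le₀ ?_ (by positivity)
    exact_mod_cast Nat.choose_le_choose i (Nat.sub_le n j)
  have hlim : Tendsto (fun n : ℕ => ∫ x in (0 : ℝ)..1,
      ‖∑ j ∈ Finset.range N, c j * (((n - j).choose ⌊((n : ℝ) + 1) * x⌋₊ : ℝ) /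
        n.choose ⌊((n : ℝ) + 1) * x⌋₊ : ℝ)‖ ^ 2) atTop
      (𝓝 (∫ x in (0 : ℝ)..1, ‖∑ j ∈ Finset.range N, c j * (((1 - x) ^ j : ℝ) : ℂ)‖ ^ 2)) := by
    refine intervalIntegral.tendsto_integral_filter_of_dominated_convergence
      (fun _ => (∑ j ∈ Finset.range N, ‖c j‖) ^ 2) ?_ ?_ (by simp) ?_
    · refine Eventually.of_forall fun n => Measurable.aestronglyMeasurable ?_
      have hm : Measurable (fun x : ℝ => ⌊((n : ℝ) + 1) * x⌋₊) :=
        Nat.measurable_floor.comp (measurable_const_mul _)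
      exact (measurable_from_top (f := fun i : ℕ => ‖∑ j ∈ Finset.range N,
        c j * (((n - j).choose i : ℝ) / n.choose i : ℝ)‖ ^ 2)).comp hm
    · refine Eventually.of_forall fun n => Eventually.of_forall fun x _ => ?_
      rw [Real.norm_of_nonneg (by positivity)]
      gcongr
      refine (norm_sum_le _ _).trans (Finset.sum_le_sum fun j _ => ?_)
      rw [norm_mul, Complex.norm_real]
      exact mul_le_of_le_one_right (norm_nonneg _) (hw _ _ _)
    · have h1 : ∀ᵐ x : ℝ, x ≠ 1 := Measure.ae_ne volume 1
      filter_upwards [h1] with x hx1 hx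
      rw [uIoc_of_le zero_le_one] at hx
      have hx' : x ∈ Ioo (0 : ℝ) 1 := ⟨hx.1, lt_of_le_of_ne hx.2 hx1⟩
      refine (tendsto_finsetSum _ fun j _ => ?_).norm.pow 2
      exact ((Complex.continuous_ofReal.tendsto _).comp
        (tendsto_choose_div_choose x hx' j)).const_mul _
  refine ge_of_tendsto (hlim.const_mul M) ?_
  filter_upwards [eventually_ge_atTop N] with n hn
  exact norm_sq_sum_mul_le f M hM c N n hn

/-- **Hausdorff's theorem** for square integrable densities, in exponential coordinates. -/
theorem L2HausdorffCondition.exists_density {f : ℕ → ℂ} (hf : L2HausdorffCondition f) :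
    ∃ G : ℝ → ℂ,
      MemLp (fun v => G v * (Real.exp (-(-(1 / 2) * v)) : ℂ)) 2 (volume.restrict (Ioi 0)) ∧
      ∀ n : ℕ, f n = ∫ v in Ioi (0 : ℝ), G v * Complex.exp (-((n : ℂ) * v)) := by
  obtain ⟨M, hM0, hM⟩ := hf
  set μ := volume.restrict (Ioi (0 : ℝ))
  -- Under `x = exp (-v)` the monomial `x ^ j` times the square root `exp (-v / 2)` of the Jacobian
  -- is this function, which makes the substitution an isometry from `L²(0, 1)` to `L²(0, ∞)`.
  have hmem : ∀ j : ℕ, MemLp (fun v : ℝ => (Real.exp (-((j + 1 / 2) * v)) : ℂ)) 2 μ := fun j => by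
    rw [memLp_two_iff_integrable_sq_norm (by fun_prop)]
    have : IntegrableOn (fun v : ℝ => Real.exp ((-(2 * j + 1)) * v)) (Ioi 0) :=
      integrableOn_exp_mul_Ioi (by have := Nat.cast_nonneg (α := ℝ) j; linarith) 0
    refine this.congr (Eventually.of_forall fun v => ?_)
    simp only [Complex.norm_real, Real.norm_eq_abs, Real.abs_exp, ← Real.exp_nat_mul]
    congr 1
    push_cast
    ring
  obtain ⟨h, hh⟩ := exists_inner_eq_of_bounded (fun j => (hmem j).toLp) f (√M) (fun c => by
    obtain ⟨N, hN⟩ : ∃ N, c.support ⊆ Finset.range N := by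
      obtain ⟨N, hN⟩ := c.support.bddAbove
      exact ⟨N + 1, fun x hx => Finset.mem_range.mpr (Nat.lt_succ_of_le (hN hx))⟩
    have e1 : Finsupp.linearCombination ℂ f c = ∑ j ∈ Finset.range N, c j * f j := by
      rw [Finsupp.linearCombination_apply, Finsupp.sum_of_support_subset _ hN _ (by simp)]
      simp
    have e2 : Finsupp.linearCombination ℂ (fun j => (hmem j).toLp) c =
        ∑ j ∈ Finset.range N, c j • (hmem j).toLp := by
      rw [Finsupp.linearCombination_apply, Finsupp.sum_of_support_subset _ hN _ (by simp)]
    have hsum : MemLp (fun v : ℝ => ∑ j ∈ Finset.range N,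
        c j * (Real.exp (-((j + 1 / 2) * v)) : ℂ)) 2 μ :=
      memLp_finsetSum _ fun j _ => (hmem j).const_mul _
    have e3 : ∑ j ∈ Finset.range N, c j • (hmem j).toLp = hsum.toLp := by
      refine Lp.ext ?_
      have h1 : ∀ j, (c j • (hmem j).toLp : Lp ℂ 2 μ) =ᵐ[μ]
          fun v => c j * (Real.exp (-((j + 1 / 2) * v)) : ℂ) := fun j => by
        filter_upwards [Lp.coeFn_smul (c j) (hmem j).toLp, (hmem j).coeFn_toLp] with v h2 h3
        rw [h2, Pi.smul_apply, h3, smul_eq_mul]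
      filter_upwards [Lp.coeFn_finsetSum (Finset.range N) fun j => c j • (hmem j).toLp,
        hsum.coeFn_toLp, ae_all_iff.mpr h1] with v h2 h3 h4
      rw [h2, h3, Finset.sum_apply]
      exact Finset.sum_congr rfl fun j _ => h4 j
    have hb := norm_sq_sum_mul_le_integral f M hM c N
    rw [← e1] at hb
    have e4 : ‖hsum.toLp‖ ^ 2 = ∫ x in (0 : ℝ)..1,
        ‖∑ j ∈ Finset.range N, c j * ((x ^ j : ℝ) : ℂ)‖ ^ 2 := by
      rw [intervalIntegral.integral_of_le zero_le_one, integral_Ioc_eq_integral_Ioo,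
        integral_Ioo_eq_integral_exp_neg]
      have h1 : ‖hsum.toLp‖ ^ 2 = ∫ v, ‖(hsum.toLp : Lp ℂ 2 μ) v‖ ^ 2 ∂μ := by
        rw [← inner_self_eq_norm_sq (𝕜 := ℂ), L2.inner_def]
        simp_rw [inner_self_eq_norm_sq_to_K]
        norm_cast
      rw [h1]
      refine integral_congr_ae ?_
      filter_upwards [hsum.coeFn_toLp] with v hv
      rw [hv]
      have h2 : ∑ j ∈ Finset.range N, c j * (Real.exp (-((j + 1 / 2) * v)) : ℂ) =
          (Real.exp (-(v / 2)) : ℂ) * ∑ j ∈ Finset.range N, c j * ((Real.exp (-v) ^ j : ℝ) : ℂ) := by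
        rw [Finset.mul_sum]
        refine Finset.sum_congr rfl fun j _ => ?_
        rw [mul_left_comm, ← Complex.ofReal_mul, ← Real.exp_nat_mul, ← Real.exp_add]
        congr 4
        ring
      rw [h2, norm_mul, mul_pow, Complex.norm_real, Real.norm_eq_abs, Real.abs_exp, smul_eq_mul,
        ← Real.exp_nat_mul]
      congr 2
      push_cast
      ring
    rw [e2, e3]
    rw [← e4] at hb
    refine abs_le_of_sq_le_sq' ?_ (by positivity) |>.2
    rw [mul_pow, Real.sq_sqrt hM0.le]
    exact hb)
  -- The inner product is conjugate-linear in its first slot, hence the conjugate. The factor `exp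
  -- (-v / 2)` comes from splitting `exp (-(n + 1/2) v)`.
  refine ⟨fun v => starRingEnd ℂ (h v) * (Real.exp (-(v / 2)) : ℂ), ?_, fun n => ?_⟩
  · have h1 : MemLp (fun v => starRingEnd ℂ (h v)) 2 μ := (Lp.memLp h).star
    refine h1.ae_eq (Eventually.of_forall fun v => ?_)
    simp only
    rw [mul_assoc, ← Complex.ofReal_mul, ← Real.exp_add]
    ring_nf
    simp
  · rw [← hh n, L2.inner_def]
    refine integral_congr_ae ?_
    filter_upwards [(hmem n).coeFn_toLp] with v hv
    rw [hv, RCLike.inner_apply']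
    rw [mul_assoc]
    congr 1
    push_cast
    rw [← Complex.exp_add]
    congr 1
    ring

/-! ### The Fourier integral and the `L²` Fourier transform -/

theorem integral_fourier_smul_schwartz (φ : 𝓢(ℝ, ℂ)) {g : ℝ → ℂ} (hg : Integrable g) :
    ∫ ξ, 𝓕 φ ξ • g ξ = ∫ x, φ x • 𝓕 g x := by
  have := VectorFourier.integral_fourierIntegral_smul_eq_flip (L := innerₗ ℝ)
    Real.continuous_fourierChar continuous_inner (φ.integrable (μ := volume)) hg
  simpa using! this

theorem integral_fourierInv_smul_schwartz (φ : 𝓢(ℝ, ℂ)) {g : ℝ → ℂ} (hg : Integrable g) :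
    ∫ ξ, 𝓕⁻ φ ξ • g ξ = ∫ x, φ x • 𝓕⁻ g x := by
  rw [Real.fourierInv_eq_fourier_comp_neg, ← integral_fourier_smul_schwartz φ hg.comp_neg,
    ← integral_neg_eq_self]
  refine integral_congr_ae (Eventually.of_forall fun x => ?_)
  simp only
  rw [SchwartzMap.fourierInv_coe, SchwartzMap.fourier_coe, Real.fourierInv_eq_fourier_neg, neg_neg]

theorem continuous_fourier {f : ℝ → ℂ} (h1 : Integrable f) : Continuous (𝓕 f) :=
  VectorFourier.fourierIntegral_continuous Real.continuous_fourierChar continuous_inner h1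

theorem ae_eq_of_schwartz {f g : ℝ → ℂ} (hf : LocallyIntegrable f) (hg : LocallyIntegrable g)
    (h : ∀ φ : 𝓢(ℝ, ℂ), ∫ x, φ x • f x = ∫ x, φ x • g x) : f =ᵐ[volume] g := by
  refine ae_eq_of_integral_contDiff_smul_eq hf hg fun φ hφ hc => ?_
  have h1 : HasCompactSupport (fun x => (φ x : ℂ)) := hc.comp_left Complex.ofReal_zero
  have h2 : ContDiff ℝ ∞ (fun x => (φ x : ℂ)) := Complex.ofRealCLM.contDiff.comp hφ
  simpa using h (h1.toSchwartzMap h2)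

/-- The `L²` Fourier transform is given by the Fourier integral on `L¹ ∩ L²`. -/
theorem fourier_toLp_ae_eq {f : ℝ → ℂ} (h1 : Integrable f) (h2 : MemLp f 2) :
    (𝓕 (h2.toLp f) : Lp ℂ 2 (volume : Measure ℝ)) =ᵐ[volume] 𝓕 f := by
  -- Both functions are tested against Schwartz functions: the `L²` transform agrees with the
  -- distributional one, and the Fourier integral obeys the multiplication formula.
  refine ae_eq_of_schwartz ((Lp.memLp _).locallyIntegrable one_le_two)
    (continuous_fourier h1).locallyIntegrable fun φ => ?_
  rw [← Lp.toTemperedDistribution_apply, ← Lp.fourier_toTemperedDistribution_eq,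
    TemperedDistribution.fourier_apply, Lp.toTemperedDistribution_apply,
    ← integral_fourier_smul_schwartz φ h1]
  refine integral_congr_ae ?_
  filter_upwards [h2.coeFn_toLp] with x hx
  rw [hx]

theorem fourierInv_toLp_ae_eq {f : ℝ → ℂ} (h1 : Integrable f) (h2 : MemLp f 2) :
    (𝓕⁻ (h2.toLp f) : Lp ℂ 2 (volume : Measure ℝ)) =ᵐ[volume] 𝓕⁻ f := by
  have hc : Continuous (𝓕⁻ f) := by
    rw [Real.fourierInv_eq_fourier_comp_neg]
    exact continuous_fourier h1.comp_neg
  refine ae_eq_of_schwartz ((Lp.memLp _).locallyIntegrable one_le_two)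
    hc.locallyIntegrable fun φ => ?_
  rw [← Lp.toTemperedDistribution_apply, ← Lp.fourierInv_toTemperedDistribution_eq,
    TemperedDistribution.fourierInv_apply, Lp.toTemperedDistribution_apply,
    ← integral_fourierInv_smul_schwartz φ h1]
  refine integral_congr_ae ?_
  filter_upwards [h2.coeFn_toLp] with x hx
  rw [hx]

/-- `L²` inversion recovers `u` from its transform, and an integrable transform is inverted by an
absolutely convergent integral. -/
theorem ae_norm_le_integral_norm_fourier (u : Lp ℂ 2 (volume : Measure ℝ))
    (h : Integrable (𝓕 u : Lp ℂ 2 (volume : Measure ℝ))) :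
    ∀ᵐ x, ‖u x‖ ≤ ∫ ξ, ‖(𝓕 u : Lp ℂ 2 (volume : Measure ℝ)) ξ‖ := by
  have h1 := fourierInv_toLp_ae_eq h (Lp.memLp _)
  rw [Lp.toLp_coeFn, FourierTransform.fourierInv_fourier_eq] at h1
  filter_upwards [h1] with x hx
  rw [hx]
  exact VectorFourier.norm_fourierIntegral_le_integral_norm _ _ _ _ _

theorem integral_norm_sq_eq_norm_sq {α : Type*} [MeasurableSpace α] {μ : Measure α}
    (u : Lp ℂ 2 μ) : ∫ x, ‖u x‖ ^ 2 ∂μ = ‖u‖ ^ 2 := by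
  rw [← inner_self_eq_norm_sq (𝕜 := ℂ), L2.inner_def]
  simp_rw [inner_self_eq_norm_sq_to_K]
  norm_cast

theorem eLpNorm_two_comp_div (h : ℝ → ℂ) :
    eLpNorm (fun ν : ℝ => h (ν / (2 * Real.pi))) 2 volume =
      ENNReal.ofReal (2 * Real.pi) ^ (1 / 2 : ℝ) * eLpNorm h 2 volume := by
  have hpi : (2 * Real.pi) ≠ 0 := by positivity
  have he : MeasurableEmbedding (fun ν : ℝ => ν / (2 * Real.pi)) := by
    simp_rw [div_eq_mul_inv]
    exact (Homeomorph.mulRight₀ _ (inv_ne_zero hpi)).measurableEmbedding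
  have hmap : Measure.map (fun ν : ℝ => ν / (2 * Real.pi)) volume =
      ENNReal.ofReal (2 * Real.pi) • volume := by
    simp_rw [div_eq_mul_inv]
    rw [Real.map_volume_mul_right (inv_ne_zero hpi), inv_inv, abs_of_pos (by positivity)]
  have h1 := he.eLpNorm_map_measure (g := h) (p := 2) (μ := volume)
  rw [hmap, eLpNorm_smul_measure_of_ne_top (by simp)] at h1
  rw [Function.comp_def] at h1
  rw [← h1]
  simp

theorem ae_comp_div {P : ℝ → Prop} (h : ∀ᵐ x, P x) :
    ∀ᵐ ν : ℝ, P (ν / (2 * Real.pi)) := by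
  have hpi : (2 * Real.pi)⁻¹ ≠ 0 := by positivity
  have hq : Measure.QuasiMeasurePreserving (fun ν : ℝ => ν / (2 * Real.pi)) volume volume := by
    refine ⟨by fun_prop, ?_⟩
    simp_rw [div_eq_mul_inv]
    rw [Real.map_volume_mul_right hpi]
    exact Measure.smul_absolutelyContinuous
  exact hq.ae h

/-! ### Laplace transforms of weighted square integrable functions -/

/-- Square integrability over `(0, ∞)` of `F v` with the weight `exp (-σ v)`. -/
def MemLaplaceTwo (F : ℝ → ℂ) (σ : ℝ) : Prop :=
  MemLp (fun v : ℝ => F v * (Real.exp (-(σ * v)) : ℂ)) 2 (volume.restrict (Ioi 0))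

noncomputable def laplaceTransform (F : ℝ → ℂ) (s : ℂ) : ℂ :=
  ∫ v in Ioi (0 : ℝ), F v * Complex.exp (-(s * v))

theorem MemLaplaceTwo.mono {F : ℝ → ℂ} {σ τ : ℝ} (h : MemLaplaceTwo F σ) (hστ : σ ≤ τ) :
    MemLaplaceTwo F τ := by
  have h1 : AEStronglyMeasurable (fun v : ℝ => F v * (Real.exp (-(τ * v)) : ℂ))
      (volume.restrict (Ioi 0)) := by
    have h2 := h.1.mul (g := fun v : ℝ => (Real.exp (-((τ - σ) * v)) : ℂ))
      (by fun_prop : Continuous fun v : ℝ => (Real.exp (-((τ - σ) * v)) : ℂ)).aestronglyMeasurable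
    refine h2.congr (Eventually.of_forall fun v => ?_)
    simp only [Pi.mul_apply]
    rw [mul_assoc, ← Complex.ofReal_mul, ← Real.exp_add]
    ring_nf
  refine MemLp.of_le h h1 ?_
  filter_upwards [ae_restrict_mem measurableSet_Ioi] with v hv
  have hv' : (0 : ℝ) < v := hv
  rw [norm_mul, norm_mul]
  simp only [Complex.norm_real, Real.norm_eq_abs, Real.abs_exp]
  gcongr

theorem memLp_exp_Ioi {δ : ℝ} (hδ : 0 < δ) :
    MemLp (fun v : ℝ => (Real.exp (-(δ * v)) : ℂ)) 2 (volume.restrict (Ioi 0)) := by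
  rw [memLp_two_iff_integrable_sq_norm (by fun_prop)]
  have : IntegrableOn (fun v : ℝ => Real.exp ((-(2 * δ)) * v)) (Ioi 0) :=
    integrableOn_exp_mul_Ioi (by linarith) 0
  refine this.congr (Eventually.of_forall fun v => ?_)
  simp only [Complex.norm_real, Real.norm_eq_abs, Real.abs_exp, ← Real.exp_nat_mul]
  congr 1
  push_cast
  ring

theorem norm_cexp_neg_mul (s : ℂ) (v : ℝ) :
    ‖Complex.exp (-(s * v))‖ = Real.exp (-(s.re * v)) := by
  rw [Complex.norm_exp]; simp

/-- Cauchy–Schwarz against `exp (-(τ - σ) v)`, which is why the inequality must be strict. -/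
theorem MemLaplaceTwo.integrable_exp {F : ℝ → ℂ} {σ τ : ℝ} (h : MemLaplaceTwo F σ) (hτ : σ < τ) :
    IntegrableOn (fun v : ℝ => F v * (Real.exp (-(τ * v)) : ℂ)) (Ioi 0) := by
  have h1 := MemLp.integrable_mul h (memLp_exp_Ioi (sub_pos.mpr hτ))
  refine h1.congr (Eventually.of_forall fun v => ?_)
  simp only [Pi.mul_apply]
  rw [mul_assoc, ← Complex.ofReal_mul, ← Real.exp_add]
  ring_nf

theorem MemLaplaceTwo.aestronglyMeasurable {F : ℝ → ℂ} {σ : ℝ} (h : MemLaplaceTwo F σ) :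
    AEStronglyMeasurable F (volume.restrict (Ioi 0)) := by
  have h2 := h.1.mul (g := fun v : ℝ => (Real.exp (σ * v) : ℂ))
    (by fun_prop : Continuous fun v : ℝ => (Real.exp (σ * v) : ℂ)).aestronglyMeasurable
  refine h2.congr (Eventually.of_forall fun v => ?_)
  simp only [Pi.mul_apply]
  rw [mul_assoc, ← Complex.ofReal_mul, ← Real.exp_add]
  simp

theorem MemLaplaceTwo.integrable_cexp {F : ℝ → ℂ} {σ : ℝ} {s : ℂ} (h : MemLaplaceTwo F σ)
    (hs : σ < s.re) :
    IntegrableOn (fun v : ℝ => F v * Complex.exp (-(s * v))) (Ioi 0) := by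
  refine Integrable.mono (h.integrable_exp hs) (h.aestronglyMeasurable.mul (by fun_prop))
    (Eventually.of_forall fun v => le_of_eq ?_)
  rw [norm_mul, norm_mul, norm_cexp_neg_mul, Complex.norm_real, Real.norm_eq_abs, Real.abs_exp]

theorem MemLaplaceTwo.integrable_norm {F : ℝ → ℂ} {σ τ : ℝ} (h : MemLaplaceTwo F σ) (hτ : σ < τ) :
    IntegrableOn (fun v : ℝ => ‖F v‖ * Real.exp (-(τ * v))) (Ioi 0) := by
  refine (h.integrable_exp hτ).norm.congr (Eventually.of_forall fun v => ?_)
  simp only [norm_mul, Complex.norm_real, Real.norm_eq_abs, Real.abs_exp]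

theorem MemLaplaceTwo.norm_laplaceTransform_le {F : ℝ → ℂ} {σ τ : ℝ} {s : ℂ}
    (h : MemLaplaceTwo F σ) (hτ : σ < τ) (hs : τ ≤ s.re) :
    ‖laplaceTransform F s‖ ≤ ∫ v in Ioi (0 : ℝ), ‖F v‖ * Real.exp (-(τ * v)) := by
  refine norm_integral_le_of_norm_le (h.integrable_norm hτ) ?_
  filter_upwards [ae_restrict_mem measurableSet_Ioi] with v hv
  have hv' : (0 : ℝ) < v := hv
  rw [norm_mul, norm_cexp_neg_mul]
  gcongr

theorem MemLaplaceTwo.differentiableOn {F : ℝ → ℂ} {σ : ℝ} (h : MemLaplaceTwo F σ) :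
    DifferentiableOn ℂ (laplaceTransform F) {s | σ < s.re} := by
  intro s hs
  have hs' : σ < s.re := hs
  -- One third is the radius of the ball, one third absorbs the factor `v` of the derivative,
  -- through `v * exp (-δ v) ≤ 1 / δ`, and one third keeps the bound integrable at `σ + δ`.
  set δ := (s.re - σ) / 3 with hδ
  have hδ0 : 0 < δ := by rw [hδ]; linarith
  refine DifferentiableAt.differentiableWithinAt ?_
  refine (hasDerivAt_integral_of_dominated_loc_of_deriv_le (s := Metric.ball s δ)
    (F := fun s v => F v * Complex.exp (-(s * v)))
    (F' := fun s v => F v * (Complex.exp (-(s * v)) * (-(v : ℂ))))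
    (bound := fun v => (1 / δ) * (‖F v‖ * Real.exp (-((σ + δ) * v))))
    (Metric.ball_mem_nhds s hδ0) ?_ (h.integrable_cexp hs') ?_ ?_ ?_ ?_).2.differentiableAt
  · exact Eventually.of_forall fun z => h.aestronglyMeasurable.mul (by fun_prop)
  · exact h.aestronglyMeasurable.mul (by fun_prop)
  · filter_upwards [ae_restrict_mem measurableSet_Ioi] with v hv z hz
    have hv' : (0 : ℝ) < v := hv
    rw [norm_mul, norm_mul, norm_cexp_neg_mul, norm_neg, Complex.norm_real, Real.norm_of_nonneg hv'.le]
    have hz' : σ + 2 * δ ≤ z.re := by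
      have h1 := (Complex.abs_re_le_norm (z - s)).trans_lt (by simpa [dist_eq_norm] using hz)
      rw [Complex.sub_re, abs_lt] at h1
      rw [hδ] at h1 ⊢; linarith [h1.1]
    have h2 : Real.exp (-(z.re * v)) ≤ Real.exp (-((σ + δ) * v)) * Real.exp (-(δ * v)) := by
      rw [← Real.exp_add]
      gcongr
      nlinarith
    have h3 : Real.exp (-(δ * v)) * v ≤ 1 / δ := by
      have := Real.add_one_le_exp (δ * v)
      rw [Real.exp_neg, inv_mul_eq_div, div_le_div_iff₀ (Real.exp_pos _) hδ0]
      linarith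
    calc ‖F v‖ * (Real.exp (-(z.re * v)) * v)
        ≤ ‖F v‖ * (Real.exp (-((σ + δ) * v)) * Real.exp (-(δ * v)) * v) := by gcongr
      _ = ‖F v‖ * Real.exp (-((σ + δ) * v)) * (Real.exp (-(δ * v)) * v) := by ring
      _ ≤ ‖F v‖ * Real.exp (-((σ + δ) * v)) * (1 / δ) := by gcongr
      _ = _ := by ring
  · exact (h.integrable_norm (by linarith)).const_mul _
  · refine Eventually.of_forall fun v z _ => ?_
    have h1 : HasDerivAt (fun z : ℂ => -(z * v)) (-(v : ℂ)) z := by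
      simpa using ((hasDerivAt_id z).mul_const (v : ℂ)).fun_neg
    exact (h1.cexp).const_mul (F v)

/-- The function `F v * exp (-σ v)` on `(0, ∞)`, extended by zero. -/
noncomputable def weighted (F : ℝ → ℂ) (σ : ℝ) : ℝ → ℂ :=
  (Ioi (0 : ℝ)).indicator fun v => F v * (Real.exp (-(σ * v)) : ℂ)

theorem MemLaplaceTwo.memLp_weighted {F : ℝ → ℂ} {σ : ℝ} (h : MemLaplaceTwo F σ) :
    MemLp (weighted F σ) 2 volume :=
  (memLp_indicator_iff_restrict measurableSet_Ioi).mpr h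

theorem fourier_weighted (F : ℝ → ℂ) (σ ξ : ℝ) :
    𝓕 (weighted F σ) ξ = laplaceTransform F (verticalPoint σ (2 * Real.pi * ξ)) := by
  rw [Real.fourier_real_eq_integral_exp_smul, laplaceTransform,
    ← integral_indicator measurableSet_Ioi]
  refine integral_congr_ae (Eventually.of_forall fun v => ?_)
  simp only [weighted, indicator_apply, smul_eq_mul, mul_ite, mul_zero]
  split_ifs
  · rw [mul_left_comm]
    push_cast
    rw [← Complex.exp_add]
    congr 2
    simp only [verticalPoint]
    push_cast
    ring
  · rfl

theorem MemLaplaceTwo.fourier_ae_eq {F : ℝ → ℂ} {σ τ : ℝ} (h : MemLaplaceTwo F σ) (hτ : σ < τ) :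
    (𝓕 ((h.mono hτ.le).memLp_weighted.toLp _) : Lp ℂ 2 (volume : Measure ℝ)) =ᵐ[volume]
      fun ξ => laplaceTransform F (verticalPoint τ (2 * Real.pi * ξ)) := by
  refine (fourier_toLp_ae_eq ?_ _).trans (Eventually.of_forall fun ξ => fourier_weighted F τ ξ)
  exact (integrable_indicator_iff measurableSet_Ioi).mpr (h.integrable_exp hτ)

theorem MemLaplaceTwo.laplace_line_ae_eq {F : ℝ → ℂ} {σ τ : ℝ} (h : MemLaplaceTwo F σ)
    (hτ : σ < τ) :
    (fun ν => laplaceTransform F (verticalPoint τ ν)) =ᵐ[volume]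
      fun ν => (𝓕 ((h.mono hτ.le).memLp_weighted.toLp _) : Lp ℂ 2 (volume : Measure ℝ))
        (ν / (2 * Real.pi)) := by
  filter_upwards [ae_comp_div (h.fourier_ae_eq hτ)] with ν hν
  rw [hν, mul_div_cancel₀ _ (by positivity)]

/-- Injectivity of the Laplace transform. -/
theorem MemLaplaceTwo.ae_eq_zero {F : ℝ → ℂ} {σ τ : ℝ} (h : MemLaplaceTwo F σ) (hτ : σ < τ)
    (h0 : ∀ ν : ℝ, laplaceTransform F (verticalPoint τ ν) = 0) :
    F =ᵐ[volume.restrict (Ioi 0)] 0 := by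
  have h1 := h.fourier_ae_eq hτ
  simp only [h0] at h1
  have h2 : (𝓕 ((h.mono hτ.le).memLp_weighted.toLp _) : Lp ℂ 2 (volume : Measure ℝ)) = 0 :=
    Lp.eq_zero_iff_ae_eq_zero.mpr h1
  have h3 : ((h.mono hτ.le).memLp_weighted.toLp _ : Lp ℂ 2 (volume : Measure ℝ)) = 0 := by
    rw [← norm_eq_zero, ← Lp.norm_fourier_eq, h2, norm_zero]
  have h4 := Lp.eq_zero_iff_ae_eq_zero.mp h3
  have h5 := ((h.mono hτ.le).memLp_weighted.coeFn_toLp).symm.trans h4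
  rw [EventuallyEq, ae_restrict_iff' measurableSet_Ioi]
  filter_upwards [h5] with v hv hv0
  rw [weighted, indicator_of_mem hv0] at hv
  simpa using hv

/-! ### Carlson's theorem -/

theorem isOpen_re_gt (σ : ℝ) : IsOpen {z : ℂ | σ < z.re} := isOpen_lt continuous_const Complex.continuous_re

/-- Schwarz lemma in the right half-plane. -/
theorem norm_mul_le_of_right_halfPlane {g : ℂ → ℂ} {M : ℝ}
    (hd : DifferentiableOn ℂ g {z | 0 < z.re}) (hM : ∀ z : ℂ, 0 < z.re → ‖g z‖ ≤ M)
    {k : ℝ} (hk : 0 < k) (h0 : g k = 0) {z : ℂ} (hz : 0 < z.re) :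
    ‖g z‖ * ‖z + k‖ ≤ M * ‖z - k‖ := by
  -- The Cayley map `w ↦ k (1 + w) / (1 - w)` takes the disc to the half-plane and `0` to `k`; its
  -- inverse is `(z - k) / (z + k)`. The Schwarz lemma in the disc then applies.
  have hre : ∀ w : ℂ, w ∈ Metric.ball (0 : ℂ) 1 → 0 < ((k : ℂ) * ((1 + w) / (1 - w))).re := by
    intro w hw
    have hw1 : ‖w‖ < 1 := by simpa using hw
    have hne : (1 - w) ≠ 0 := fun h => by
      rw [sub_eq_zero] at h; rw [← h] at hw1; simp at hw1
    rw [Complex.re_ofReal_mul]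
    refine mul_pos hk ?_
    rw [Complex.div_re, ← add_div]
    refine div_pos ?_ (Complex.normSq_pos.mpr hne)
    have h1 : ‖w‖ ^ 2 < 1 := by nlinarith [norm_nonneg w]
    rw [← Complex.normSq_eq_norm_sq, Complex.normSq_apply] at h1
    simp
    nlinarith
  have hG : DifferentiableOn ℂ (fun w : ℂ => g (k * ((1 + w) / (1 - w)))) (Metric.ball 0 1) := by
    refine hd.comp ?_ hre
    refine DifferentiableOn.const_mul (DifferentiableOn.div (by fun_prop) (by fun_prop) ?_) _
    intro w hw h
    have hw1 : ‖w‖ < 1 := by simpa using hw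
    rw [sub_eq_zero] at h; rw [← h] at hw1; simp at hw1
  have hzk : z + k ≠ 0 := fun h => by
    have := congrArg Complex.re h
    simp at this; linarith
  have hw : (z - k) / (z + k) ∈ Metric.ball (0 : ℂ) 1 := by
    rw [mem_ball_zero_iff, norm_div, div_lt_one (norm_pos_iff.mpr hzk)]
    rw [← sq_lt_sq₀ (norm_nonneg _) (norm_nonneg _), ← Complex.normSq_eq_norm_sq,
      ← Complex.normSq_eq_norm_sq, Complex.normSq_apply, Complex.normSq_apply]
    simp
    nlinarith [mul_pos hk hz]
  have h1 := Complex.dist_le_div_mul_dist_of_mapsTo_ball (R₂ := M) hG (fun w hw => by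
    simpa [h0] using hM _ (hre w hw)) hw
  have hk' : (k : ℂ) ≠ 0 := by exact_mod_cast hk.ne'
  have e : (k : ℂ) * ((1 + (z - k) / (z + k)) / (1 - (z - k) / (z + k))) = z := by
    have : 1 - (z - k) / (z + k) = 2 * k / (z + k) := by field_simp; ring
    rw [this]
    field_simp
    ring
  simp only [e, add_zero, sub_zero, div_one, mul_one, h0, dist_zero_right, norm_div] at h1
  rw [← mul_div_assoc, le_div_iff₀ (norm_pos_iff.mpr hzk)] at h1
  exact h1

/-- Dividing out one Blaschke factor `(z - k) / (z + k)` keeps the bound `M` and the remaining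
zeros, so the zeros can be removed one by one. -/
theorem norm_mul_prod_le_of_right_halfPlane (S : Finset ℕ) : ∀ (g : ℂ → ℂ) (M : ℝ),
    DifferentiableOn ℂ g {z | 0 < z.re} → (∀ z : ℂ, 0 < z.re → ‖g z‖ ≤ M) →
    (∀ k ∈ S, 0 < k) → (∀ k ∈ S, g (k : ℂ) = 0) → ∀ z : ℂ, 0 < z.re →
    ‖g z‖ * ∏ k ∈ S, ‖z + k‖ ≤ M * ∏ k ∈ S, ‖z - k‖ := by
  induction S using Finset.induction_on with
  | empty => intro g M _ hM _ _ z hz; simpa using hM z hz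
  | insert k S hkS ih =>
    intro g M hd hM hpos h0 z hz
    have hk : (0 : ℝ) < k := by exact_mod_cast hpos k (Finset.mem_insert_self _ _)
    have hk0 : g (k : ℂ) = 0 := h0 k (Finset.mem_insert_self _ _)
    have hnhds : {z : ℂ | 0 < z.re} ∈ 𝓝 (k : ℂ) := (isOpen_re_gt 0).mem_nhds (by simpa using hk)
    -- This is `g z * (z + k) / (z - k)`, with the removable singularity at `k` filled in. The bound
    -- at `k` itself follows by continuity.
    set q : ℂ → ℂ := fun z => dslope g k z * (z + k)
    have hq : DifferentiableOn ℂ q {z | 0 < z.re} :=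
      ((Complex.differentiableOn_dslope hnhds).mpr hd).mul (by fun_prop)
    have hqz : ∀ z : ℂ, q z * (z - k) = g z * (z + k) := fun z => by
      have h1 := sub_smul_dslope g (k : ℂ) z
      rw [hk0, sub_zero, smul_eq_mul] at h1
      simp only [q]
      rw [← h1]; ring
    have hqM' : ∀ z : ℂ, 0 < z.re → z ≠ k → ‖q z‖ ≤ M := fun z hz hne => by
      have h1 := norm_mul_le_of_right_halfPlane hd hM hk (by simpa using hk0) hz
      rw [Complex.ofReal_natCast, ← norm_mul, ← hqz z, norm_mul] at h1
      exact le_of_mul_le_mul_right h1 (norm_pos_iff.mpr (sub_ne_zero.mpr hne))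
    have hqM : ∀ z : ℂ, 0 < z.re → ‖q z‖ ≤ M := fun z hz => by
      by_cases hne : z = k
      · subst hne
        have hc : ContinuousAt q k := (hq.differentiableAt hnhds).continuousAt
        have ht : Tendsto (fun z => ‖q z‖) (𝓝[≠] (k : ℂ)) (𝓝 ‖q k‖) :=
          (hc.tendsto.mono_left nhdsWithin_le_nhds).norm
        refine le_of_tendsto ht ?_
        filter_upwards [nhdsWithin_le_nhds hnhds, self_mem_nhdsWithin] with w hw hw2
        exact hqM' w hw hw2
      · exact hqM' z hz hne
    have h1 := ih q M hq hqM (fun j hj => hpos j (Finset.mem_insert_of_mem hj)) (fun j hj => by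
      have h2 := hqz j
      rw [h0 j (Finset.mem_insert_of_mem hj), zero_mul, mul_eq_zero] at h2
      refine h2.resolve_right ?_
      rw [sub_eq_zero]
      intro h
      exact hkS (by rwa [← (Nat.cast_injective h : j = k)])) z hz
    rw [Finset.prod_insert hkS, Finset.prod_insert hkS]
    calc ‖g z‖ * (‖z + k‖ * ∏ k ∈ S, ‖z + k‖)
        = ‖z - k‖ * (‖q z‖ * ∏ k ∈ S, ‖z + k‖) := by
          rw [← mul_assoc, ← norm_mul, ← hqz z, norm_mul]; ring
      _ ≤ ‖z - k‖ * (M * ∏ k ∈ S, ‖z - k‖) := by gcongr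
      _ = _ := by ring

/-- With `K = k + 1`, `‖z - K‖² = ‖z + K‖² - 4 K Re z` and `‖z + K‖ ≤ K (1 + ‖z‖)`, so a Blaschke
factor is at most `exp (-c / K)`; the exponents sum to a divergent harmonic series. -/
theorem norm_sub_natCast_le {z : ℂ} (hz : 0 < z.re) (k : ℕ) :
    ‖z - (k + 1 : ℕ)‖ ≤ ‖z + (k + 1 : ℕ)‖ *
      Real.exp (-(2 * z.re / (1 + ‖z‖) ^ 2 * (1 / ((k : ℝ) + 1)))) := by
  set K : ℝ := (k : ℝ) + 1 with hK
  have hK1 : 1 ≤ K := by rw [hK]; have := Nat.cast_nonneg (α := ℝ) k; linarith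
  have hcast : ((k + 1 : ℕ) : ℂ) = (K : ℂ) := by rw [hK]; push_cast; ring
  rw [hcast]
  have hpos : 0 < ‖z + K‖ := by
    rw [norm_pos_iff]
    intro h
    have := congrArg Complex.re h
    simp at this; linarith
  rw [← sq_le_sq₀ (norm_nonneg _) (by positivity), mul_pow, ← Real.exp_nat_mul]
  have e1 : ‖z - K‖ ^ 2 = ‖z + K‖ ^ 2 - 4 * K * z.re := by
    rw [← Complex.normSq_eq_norm_sq, ← Complex.normSq_eq_norm_sq, Complex.normSq_apply,
      Complex.normSq_apply]
    simp; ring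
  have h2 : ‖z + K‖ ≤ K * (1 + ‖z‖) := by
    refine (norm_add_le _ _).trans ?_
    rw [Complex.norm_real, Real.norm_of_nonneg (by linarith)]
    nlinarith [norm_nonneg z]
  have h3 := Real.add_one_le_exp (-(4 * z.re / (1 + ‖z‖) ^ 2 * (1 / K)))
  have h4 : ‖z + K‖ ^ 2 * (4 * z.re / (1 + ‖z‖) ^ 2 * (1 / K)) ≤ 4 * K * z.re := by
    have h5 : ‖z + K‖ ^ 2 ≤ (K * (1 + ‖z‖)) ^ 2 := by gcongr
    have h6 : 0 < 1 + ‖z‖ := by positivity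
    calc ‖z + K‖ ^ 2 * (4 * z.re / (1 + ‖z‖) ^ 2 * (1 / K))
        ≤ (K * (1 + ‖z‖)) ^ 2 * (4 * z.re / (1 + ‖z‖) ^ 2 * (1 / K)) := by gcongr
      _ = _ := by field_simp
  have e2 : ((2 : ℕ) : ℝ) * -(2 * z.re / (1 + ‖z‖) ^ 2 * (1 / K)) =
      -(4 * z.re / (1 + ‖z‖) ^ 2 * (1 / K)) := by push_cast; ring
  rw [e1, e2]
  have h7 := mul_le_mul_of_nonneg_left h3 (sq_nonneg ‖z + K‖)
  nlinarith

/-- **Carlson's theorem** for bounded functions in the right half-plane. -/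
theorem eq_zero_of_bounded_of_natCast {g : ℂ → ℂ} {M : ℝ}
    (hd : DifferentiableOn ℂ g {z | 0 < z.re}) (hM : ∀ z : ℂ, 0 < z.re → ‖g z‖ ≤ M)
    (h0 : ∀ n : ℕ, 0 < n → g (n : ℂ) = 0) {z : ℂ} (hz : 0 < z.re) : g z = 0 := by
  set c := 2 * z.re / (1 + ‖z‖) ^ 2
  have hc : 0 < c := by positivity
  have hM0 : 0 ≤ M := (norm_nonneg _).trans (hM z hz)
  have hN : ∀ N : ℕ, ‖g z‖ ≤ M * Real.exp (-(c * ∑ k ∈ Finset.range N, 1 / ((k : ℝ) + 1))) := by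
    intro N
    have h1 := norm_mul_prod_le_of_right_halfPlane ((Finset.range N).map ⟨Nat.succ, Nat.succ_injective⟩)
      g M hd hM (by simp) (by
        intro k hk
        obtain ⟨j, -, rfl⟩ := Finset.mem_map.mp hk
        exact h0 _ (Nat.succ_pos j)) z hz
    rw [Finset.prod_map, Finset.prod_map] at h1
    simp only [Function.Embedding.coeFn_mk, Nat.succ_eq_add_one] at h1
    have hp : 0 < ∏ k ∈ Finset.range N, ‖z + (k + 1 : ℕ)‖ := by
      refine Finset.prod_pos fun k _ => norm_pos_iff.mpr fun h => ?_
      have := congrArg Complex.re h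
      simp at this
      have := Nat.cast_nonneg (α := ℝ) k
      linarith
    have h2 : ∏ k ∈ Finset.range N, ‖z - (k + 1 : ℕ)‖ ≤
        (∏ k ∈ Finset.range N, ‖z + (k + 1 : ℕ)‖) *
          Real.exp (-(c * ∑ k ∈ Finset.range N, 1 / ((k : ℝ) + 1))) := by
      rw [Finset.mul_sum, ← Finset.sum_neg_distrib, Real.exp_sum, ← Finset.prod_mul_distrib]
      exact Finset.prod_le_prod (fun _ _ => norm_nonneg _) fun k _ => norm_sub_natCast_le hz k
    refine le_of_mul_le_mul_right ?_ hp
    calc _ ≤ _ := h1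
      _ ≤ _ := mul_le_mul_of_nonneg_left h2 hM0
      _ = _ := by ring
  have hlim : Tendsto (fun N : ℕ => M * Real.exp (-(c * ∑ k ∈ Finset.range N, 1 / ((k : ℝ) + 1))))
      atTop (𝓝 (M * 0)) := by
    refine Tendsto.const_mul M (Real.tendsto_exp_neg_atTop_nhds_zero.comp ?_)
    exact Real.tendsto_sum_range_one_div_nat_succ_atTop.const_mul_atTop hc
  rw [mul_zero] at hlim
  exact norm_le_zero_iff.mp (ge_of_tendsto' hlim hN)

/-! ### Boundedness of `H²` functions away from the boundary line -/

theorem two_pi_mul_enorm_le_lintegral_circle {g : ℂ → ℂ} {c : ℂ} {r : ℝ} (hr : 0 ≤ r)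
    (hd : DifferentiableOn ℂ g (Metric.closedBall c r)) :
    ENNReal.ofReal (2 * Real.pi) * ‖g c‖ₑ ≤
      ∫⁻ t in Ioo (-Real.pi) Real.pi, ‖g (circleMap c r t)‖ₑ := by
  have hdc : DiffContOnCl ℂ g (Metric.ball c |r|) := by
    refine DifferentiableOn.diffContOnCl (hd.mono ?_)
    rw [abs_of_nonneg hr]
    exact Metric.closure_ball_subset_closedBall
  have h1 := hdc.circleAverage
  rw [Real.circleAverage_def] at h1
  have hper : Function.Periodic (fun θ => g (circleMap c r θ)) (2 * Real.pi) := fun θ => by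
    simp only [periodic_circleMap c r θ]
  have h2 := hper.intervalIntegral_add_eq 0 (-Real.pi)
  rw [zero_add, show -Real.pi + 2 * Real.pi = Real.pi by ring] at h2
  rw [h2, intervalIntegral.integral_of_le (by linarith [Real.pi_pos]),
    integral_Ioc_eq_integral_Ioo] at h1
  have h3 : (2 * Real.pi) • g c = ∫ t in Ioo (-Real.pi) Real.pi, g (circleMap c r t) := by
    rw [← h1, smul_inv_smul₀ (by positivity)]
  calc ENNReal.ofReal (2 * Real.pi) * ‖g c‖ₑ = ‖(2 * Real.pi) • g c‖ₑ := by
        rw [enorm_smul, Real.enorm_of_nonneg (by positivity)]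
    _ ≤ _ := by rw [h3]; exact enorm_integral_le_lintegral_enorm _

/-- The mean value inequality is integrated over the circles of radius `r` between `R / 2` and `R`.
One factor `R / 2` bounds the polar Jacobian from below, the other is the length of the range of
`r`. -/
theorem enorm_le_lintegral_ball {g : ℂ → ℂ} {c : ℂ} {R : ℝ} (hR : 0 < R)
    (hd : DifferentiableOn ℂ g (Metric.ball c R)) :
    ENNReal.ofReal (R / 2) * (ENNReal.ofReal (R / 2) * (ENNReal.ofReal (2 * Real.pi) * ‖g c‖ₑ)) ≤
      ∫⁻ w in Metric.ball 0 R, ‖g (c + w)‖ₑ := by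
  rw [← lintegral_indicator Metric.isOpen_ball.measurableSet, ← Complex.lintegral_comp_polarCoord_symm]
  have hsub : Ioo (R / 2) R ×ˢ Ioo (-Real.pi) Real.pi ⊆ Complex.polarCoord.target := by
    rw [Complex.polarCoord_target]
    exact prod_mono (fun r hr => lt_trans (by positivity) hr.1) subset_rfl
  refine le_trans ?_ (lintegral_mono_set hsub)
  have hcm : ∀ p : ℝ × ℝ, circleMap c p.1 p.2 = c + Complex.polarCoord.symm p := fun p => by
    rw [circleMap, Complex.polarCoord_symm_apply, Complex.exp_mul_I]
    push_cast
    rfl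
  have hmem : ∀ p ∈ Ioo (R / 2) R ×ˢ Ioo (-Real.pi) Real.pi, p.1 ∈ Ioo (R / 2) R := fun p hp => hp.1
  have hball : ∀ p ∈ Ioo (R / 2) R ×ˢ Ioo (-Real.pi) Real.pi,
      circleMap c p.1 p.2 ∈ Metric.ball c R := fun p hp => by
    have := hmem p hp
    have h := circleMap_mem_sphere c (lt_trans (by positivity) this.1 : 0 < p.1).le p.2
    rw [Metric.mem_ball, Metric.mem_sphere.mp h]
    exact this.2
  have hmeas : MeasurableSet (Ioo (R / 2) R ×ˢ Ioo (-Real.pi) Real.pi) :=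
    measurableSet_Ioo.prod measurableSet_Ioo
  have h1 : ∫⁻ p in Ioo (R / 2) R ×ˢ Ioo (-Real.pi) Real.pi,
        ENNReal.ofReal (R / 2) * ‖g (circleMap c p.1 p.2)‖ₑ ≤
      ∫⁻ p in Ioo (R / 2) R ×ˢ Ioo (-Real.pi) Real.pi, ENNReal.ofReal p.1 •
        (Metric.ball (0 : ℂ) R).indicator (fun w => ‖g (c + w)‖ₑ) (Complex.polarCoord.symm p) := by
    refine setLIntegral_mono' hmeas fun p hp => ?_
    have h2 := hball p hp
    rw [hcm] at h2
    rw [indicator_of_mem (by simpa [dist_eq_norm] using h2), ← hcm, smul_eq_mul]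
    gcongr
    exact (hmem p hp).1.le
  refine le_trans ?_ h1
  have hcont : ContinuousOn (fun p : ℝ × ℝ => g (circleMap c p.1 p.2))
      (Ioo (R / 2) R ×ˢ Ioo (-Real.pi) Real.pi) := by
    refine hd.continuousOn.comp ?_ hball
    simp only [circleMap]
    fun_prop
  have haem : AEMeasurable (fun p : ℝ × ℝ => ‖g (circleMap c p.1 p.2)‖ₑ)
      (volume.restrict (Ioo (R / 2) R ×ˢ Ioo (-Real.pi) Real.pi)) :=
    (hcont.aemeasurable hmeas).enorm
  rw [lintegral_const_mul'' _ haem]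
  gcongr
  rw [Measure.volume_eq_prod, ← Measure.prod_restrict] at haem ⊢
  rw [lintegral_prod _ haem]
  calc ENNReal.ofReal (R / 2) * (ENNReal.ofReal (2 * Real.pi) * ‖g c‖ₑ)
      = ∫⁻ _ in Ioo (R / 2) R, ENNReal.ofReal (2 * Real.pi) * ‖g c‖ₑ := by
        rw [setLIntegral_const, Real.volume_Ioo, mul_comm, sub_half]
    _ ≤ _ := by
        refine setLIntegral_mono' measurableSet_Ioo fun r hr => ?_
        refine two_pi_mul_enorm_le_lintegral_circle (lt_trans (by positivity) hr.1).le
          (hd.mono (Metric.closedBall_subset_ball hr.2))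

/-- Passing to a box makes the inner integral run along vertical segments, where the `H²` bound is
available. The box lies in the ball of radius `2 * R`, where continuity gives the measurability
needed for Tonelli. -/
theorem lintegral_ball_le_lintegral_box (φ : ℂ → ℝ≥0∞) (R : ℝ)
    (hφ : ContinuousOn φ (Metric.ball 0 (2 * R))) :
    ∫⁻ w in Metric.ball 0 R, φ w ≤
      ∫⁻ x in Ioo (-R) R, ∫⁻ y in Ioo (-R) R, φ (verticalPoint x y) := by
  have he := Complex.volume_preserving_equiv_real_prod.symm
  have hv : ∀ p : ℝ × ℝ, Complex.measurableEquivRealProd.symm p = verticalPoint p.1 p.2 := fun p => by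
    rw [Complex.measurableEquivRealProd_symm_apply]
    apply Complex.ext <;> simp [verticalPoint]
  rw [← lintegral_indicator Metric.isOpen_ball.measurableSet,
    ← he.lintegral_comp_emb Complex.measurableEquivRealProd.symm.measurableEmbedding]
  have hmeas : MeasurableSet (Ioo (-R) R ×ˢ Ioo (-R) R) := measurableSet_Ioo.prod measurableSet_Ioo
  calc _ ≤ ∫⁻ p in Ioo (-R) R ×ˢ Ioo (-R) R, φ (verticalPoint p.1 p.2) := by
        rw [← lintegral_indicator hmeas]
        refine lintegral_mono fun p => ?_
        rw [hv]
        by_cases hp : verticalPoint p.1 p.2 ∈ Metric.ball (0 : ℂ) R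
        · have hn : ‖verticalPoint p.1 p.2‖ < R := by simpa using hp
          have h1 := (Complex.abs_re_le_norm _).trans_lt hn
          have h2 := (Complex.abs_im_le_norm _).trans_lt hn
          simp only [verticalPoint, Complex.add_re, Complex.ofReal_re, Complex.re_ofReal_mul,
            Complex.I_re, mul_zero, add_zero, abs_lt] at h1
          simp only [verticalPoint, Complex.add_im, Complex.ofReal_im, Complex.im_ofReal_mul,
            Complex.I_im, mul_one, zero_add, abs_lt] at h2
          rw [indicator_of_mem hp, indicator_of_mem (mem_prod.mpr ⟨h1, h2⟩ : p ∈ Ioo (-R) R ×ˢ Ioo (-R) R)]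
        · rw [indicator_of_notMem hp]; exact zero_le
    _ = _ := by
        have h1 : ContinuousOn (fun p : ℝ × ℝ => φ (verticalPoint p.1 p.2))
            (Ioo (-R) R ×ˢ Ioo (-R) R) := by
          refine hφ.comp ?_ ?_
          · simp only [verticalPoint]; fun_prop
          · rintro p ⟨h1, h2⟩
            have h3 := Complex.norm_le_abs_re_add_abs_im (verticalPoint p.1 p.2)
            have h4 := abs_lt.mpr h1
            have h5 := abs_lt.mpr h2
            simp only [verticalPoint, Complex.add_re, Complex.ofReal_re, Complex.re_ofReal_mul,
              Complex.I_re, mul_zero, add_zero, Complex.add_im, Complex.ofReal_im,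
              Complex.im_ofReal_mul, Complex.I_im, mul_one, zero_add] at h3
            rw [mem_ball_zero_iff]
            simp only [verticalPoint]
            linarith
        have h2 := h1.aemeasurable (μ := volume) hmeas
        rw [Measure.volume_eq_prod, ← Measure.prod_restrict] at h2 ⊢
        rw [lintegral_prod _ h2]

theorem continuous_verticalPoint (σ : ℝ) : Continuous (verticalPoint σ) := by
  unfold verticalPoint; fun_prop

theorem verticalPoint_re (σ ν : ℝ) : (verticalPoint σ ν).re = σ := by simp [verticalPoint]

theorem verticalPoint_im (σ ν : ℝ) : (verticalPoint σ ν).im = ν := by simp [verticalPoint]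

theorem continuous_comp_verticalPoint {g : ℂ → ℂ} {σ τ : ℝ}
    (hg : DifferentiableOn ℂ g {z | σ < z.re}) (hτ : σ < τ) :
    Continuous fun ν : ℝ => g (verticalPoint τ ν) :=
  hg.continuousOn.comp_continuous (continuous_verticalPoint τ) fun ν => by
    simpa [verticalPoint_re] using hτ

/-- A function of `H²` is bounded in smaller half-planes. -/
theorem bounded_right_halfPlane_of_eLpNorm_le {g : ℂ → ℂ}
    (hd : DifferentiableOn ℂ g {z : ℂ | -(1 / 2 : ℝ) < z.re}) (C : NNReal)
    (hC : ∀ σ : ℝ, -(1 / 2 : ℝ) < σ →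
      eLpNorm (fun ν : ℝ => g (verticalPoint σ ν)) 2 volume ≤ C) :
    ∃ B : ℝ, ∀ z : ℂ, 0 < z.re → ‖g z‖ ≤ B := by
  -- Small enough that the ball of radius `2 * R` around a point with `Re c > 0` stays inside `Re z
  -- > -1/2`.
  set R : ℝ := 1 / 8 with hR
  set A : ℝ≥0∞ := ENNReal.ofReal (R / 2) * (ENNReal.ofReal (R / 2) * ENNReal.ofReal (2 * Real.pi))
  have hA0 : A ≠ 0 := by
    simp only [A, ne_eq, mul_eq_zero, ENNReal.ofReal_eq_zero, not_or, not_le]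
    exact ⟨by positivity, by positivity, by positivity⟩
  have hAt : A ≠ ⊤ := by simp [A, ENNReal.mul_eq_top]
  set B : ℝ≥0∞ := C * ENNReal.ofReal (2 * R) ^ (1 - 1 / 2 : ℝ) * ENNReal.ofReal (2 * R)
  have hB : B ≠ ⊤ := by
    refine ENNReal.mul_ne_top (ENNReal.mul_ne_top (by simp) ?_) ENNReal.ofReal_ne_top
    exact ENNReal.rpow_ne_top_of_nonneg (by norm_num) ENNReal.ofReal_ne_top
  refine ⟨(B / A).toReal, fun c hc => ?_⟩
  have hball : Metric.ball c (2 * R) ⊆ {z : ℂ | -(1 / 2 : ℝ) < z.re} := fun z hz => by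
    have h1 := (Complex.abs_re_le_norm (z - c)).trans_lt (by simpa [dist_eq_norm] using hz)
    rw [Complex.sub_re, abs_lt] at h1
    rw [mem_ofPred_eq]
    rw [hR] at h1
    linarith [h1.1]
  have h1 := enorm_le_lintegral_ball (R := R) (by positivity)
    (hd.mono ((Metric.ball_subset_ball (by rw [hR]; norm_num)).trans hball))
  have h2 := lintegral_ball_le_lintegral_box (fun w => ‖g (c + w)‖ₑ) R (by
    refine continuous_enorm.comp_continuousOn ((hd.continuousOn.mono hball).comp (by fun_prop) ?_)
    intro w hw
    simpa [dist_eq_norm] using hw)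
  have h3 : ∫⁻ x in Ioo (-R) R, ∫⁻ y in Ioo (-R) R, ‖g (c + verticalPoint x y)‖ₑ ≤ B := by
    calc _ ≤ ∫⁻ _ in Ioo (-R) R, (C : ℝ≥0∞) * ENNReal.ofReal (2 * R) ^ (1 - 1 / 2 : ℝ) := by
          refine setLIntegral_mono' measurableSet_Ioo fun x hx => ?_
          have hσ : -(1 / 2 : ℝ) < c.re + x := by have := hx.1; rw [hR] at this; linarith
          have hcont := continuous_comp_verticalPoint hd hσ
          have e : ∀ y, c + verticalPoint x y = verticalPoint (c.re + x) (c.im + y) := fun y => by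
            apply Complex.ext <;> simp [verticalPoint]
          -- Hölder on a segment of length `2 * R` bounds the `L¹` norm by the `L²` norm on the
          -- whole vertical line.
          have h4 := eLpNorm_le_eLpNorm_mul_rpow_measure_univ (p := 1) (q := 2)
            (μ := volume.restrict (Ioo (-R) R)) (by norm_num)
            (f := fun y => g (verticalPoint (c.re + x) (c.im + y)))
            (hcont.comp (continuous_const.add continuous_id)).aestronglyMeasurable
          rw [eLpNorm_one_eq_lintegral_enorm] at h4
          simp only [e]
          refine h4.trans ?_
          rw [Measure.restrict_apply_univ, Real.volume_Ioo]
          have h5 : eLpNorm (fun y => g (verticalPoint (c.re + x) (c.im + y))) 2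
              (volume.restrict (Ioo (-R) R)) ≤ C := by
            refine (eLpNorm_mono_measure _ Measure.restrict_le_self).trans ?_
            refine le_trans (le_of_eq ?_) (hC _ hσ)
            exact eLpNorm_comp_measurePreserving hcont.aestronglyMeasurable
              (measurePreserving_add_left volume c.im)
          have h6 : R - -R = 2 * R := by ring
          rw [h6]
          have h7 : (1 / (1 : ℝ≥0∞).toReal - 1 / (2 : ℝ≥0∞).toReal) = (1 - 1 / 2 : ℝ) := by simp
          rw [h7]
          gcongr
      _ = B := by
          rw [setLIntegral_const, Real.volume_Ioo, show R - -R = 2 * R by ring]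
  have h4 := (h1.trans h2).trans h3
  have h5 : ‖g c‖ₑ ≤ B / A := by
    rw [ENNReal.le_div_iff_mul_le (Or.inl hA0) (Or.inl hAt), mul_comm]
    simpa only [A, mul_assoc] using h4
  rw [← toReal_enorm]
  exact ENNReal.toReal_mono (ENNReal.div_ne_top hB hA0) h5

/-! ### Repeated antiderivatives -/

noncomputable def antiderivFromZero (F : ℝ → ℂ) (v : ℝ) : ℂ := ∫ u in (0 : ℝ)..v, F u

theorem MemLaplaceTwo.integrableOn_Ioc {F : ℝ → ℂ} {σ : ℝ} (h : MemLaplaceTwo F σ) {a b : ℝ}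
    (ha : 0 ≤ a) : IntegrableOn F (Ioc a b) := by
  have hsub : Ioc a b ⊆ Ioi 0 := fun x hx => lt_of_le_of_lt ha hx.1
  have h1 := ((h.integrable_norm (lt_add_one σ)).mono_set hsub).const_mul (Real.exp (|σ + 1| * b))
  refine h1.mono' (h.aestronglyMeasurable.mono_measure (Measure.restrict_mono_set _ hsub)) ?_
  filter_upwards [ae_restrict_mem measurableSet_Ioc] with v hv
  have hv0 : 0 < v := hsub hv
  rw [mul_left_comm, ← Real.exp_add]
  refine le_mul_of_one_le_right (norm_nonneg _) (Real.one_le_exp ?_)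
  have h2 := mul_le_mul_of_nonneg_left hv.2 (abs_nonneg (σ + 1))
  have h3 := mul_le_mul_of_nonneg_right (le_abs_self (σ + 1)) hv0.le
  linarith

/-- Cauchy–Schwarz on `[w, v]`, with `exp (|σ| v)` paying for the weight. This local Hölder estimate
of exponent `1/2` is what the Plemelj formula needs. -/
theorem MemLaplaceTwo.norm_antideriv_sub_le {F : ℝ → ℂ} {σ : ℝ} (h : MemLaplaceTwo F σ)
    {w v : ℝ} (hw : 0 ≤ w) (hwv : w ≤ v) :
    ‖antiderivFromZero F v - antiderivFromZero F w‖ ≤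
      Real.exp (|σ| * v) * (√(∫ u in Ioi (0 : ℝ), ‖F u * (Real.exp (-(σ * u)) : ℂ)‖ ^ 2) *
        √(v - w)) := by
  have hsub : Ioc w v ⊆ Ioi 0 := fun x hx => lt_of_le_of_lt hw hx.1
  have hint : ∀ {a b : ℝ}, 0 ≤ a → a ≤ b → IntervalIntegrable F volume a b := fun ha hab =>
    (intervalIntegrable_iff_integrableOn_Ioc_of_le hab).mpr (h.integrableOn_Ioc ha)
  rw [antiderivFromZero, antiderivFromZero,
    intervalIntegral.integral_interval_sub_left (hint le_rfl (hw.trans hwv)) (hint le_rfl hw),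
    intervalIntegral.integral_of_le hwv]
  set U := fun u : ℝ => ‖F u * (Real.exp (-(σ * u)) : ℂ)‖
  have hU : MemLp U 2 (volume.restrict (Ioc w v)) := (MemLp.mono_measure (Measure.restrict_mono_set _ hsub) h).norm
  have hone : MemLp (fun _ : ℝ => (1 : ℝ)) 2 (volume.restrict (Ioc w v)) := memLp_const 1
  have h1 : ∫ u in Ioc w v, U u * 1 ≤ √(∫ u in Ioc w v, U u ^ 2) * √(v - w) := by
    have h2 := integral_mul_le_Lp_mul_Lq_of_nonneg (p := 2) (q := 2) (μ := volume.restrict (Ioc w v))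
      ⟨by norm_num, by norm_num, by norm_num⟩ (f := U) (g := fun _ => 1)
      (Eventually.of_forall fun u => norm_nonneg _) (Eventually.of_forall fun u => zero_le_one)
      (by simpa using hU) (by simpa using hone)
    refine h2.trans (le_of_eq ?_)
    rw [Real.sqrt_eq_rpow, Real.sqrt_eq_rpow]
    simp [hwv]
  have h3 : ∫ u in Ioc w v, U u ^ 2 ≤ ∫ u in Ioi (0 : ℝ), U u ^ 2 := by
    refine setIntegral_mono_set ?_ (Eventually.of_forall fun u => by positivity)
      (Eventually.of_forall hsub)
    exact (memLp_two_iff_integrable_sq_norm h.1).mp h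
  have hUi : IntegrableOn U (Ioc w v) := hU.integrable one_le_two
  refine (norm_integral_le_of_norm_le (hUi.const_mul (Real.exp (|σ| * v))) ?_).trans ?_
  · filter_upwards [ae_restrict_mem measurableSet_Ioc] with u hu
    have hu0 : 0 < u := hsub hu
    simp only [U]
    rw [norm_mul, Complex.norm_real, Real.norm_eq_abs, Real.abs_exp, mul_left_comm, ← Real.exp_add]
    refine le_mul_of_one_le_right (norm_nonneg _) (Real.one_le_exp ?_)
    have h2 := mul_le_mul_of_nonneg_left hu.2 (abs_nonneg σ)
    have h3 := mul_le_mul_of_nonneg_right (le_abs_self σ) hu0.le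
    linarith
  · rw [integral_const_mul]
    simp only [mul_one] at h1
    gcongr
    exact h1.trans (by gcongr)

theorem MemLaplaceTwo.continuousOn_antideriv {F : ℝ → ℂ} {σ : ℝ} (h : MemLaplaceTwo F σ) :
    ContinuousOn (antiderivFromZero F) (Ioi 0) := by
  intro v hv
  have hv' : (0 : ℝ) < v := hv
  refine ContinuousAt.continuousWithinAt ?_
  have h1 : IntegrableOn F (uIcc 0 (v + 1)) := by
    rw [uIcc_of_le (by linarith), integrableOn_Icc_iff_integrableOn_Ioc]
    exact h.integrableOn_Ioc le_rfl
  have h2 := intervalIntegral.continuousOn_primitive_interval h1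
  rw [uIcc_of_le (by linarith)] at h2
  exact h2.continuousAt (Icc_mem_nhds hv' (by linarith))

theorem MemLaplaceTwo.norm_antideriv_le {F : ℝ → ℂ} {σ : ℝ} (h : MemLaplaceTwo F σ) {τ v : ℝ}
    (hτ : σ < τ) (hτ0 : 0 ≤ τ) (hv : 0 < v) :
    ‖antiderivFromZero F v‖ ≤
      (∫ u in Ioi (0 : ℝ), ‖F u‖ * Real.exp (-(τ * u))) * Real.exp (τ * v) := by
  rw [antiderivFromZero, intervalIntegral.integral_of_le hv.le, mul_comm, ← integral_const_mul]
  have hsub : Ioc 0 v ⊆ Ioi 0 := fun x hx => hx.1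
  have hi := (h.integrable_norm hτ).const_mul (Real.exp (τ * v))
  refine (norm_integral_le_of_norm_le (IntegrableOn.mono_set hi hsub) ?_).trans
    (setIntegral_mono_set hi (Eventually.of_forall fun u => by positivity)
      (Eventually.of_forall hsub))
  filter_upwards [ae_restrict_mem measurableSet_Ioc] with u hu
  rw [mul_left_comm, ← Real.exp_add]
  refine le_mul_of_one_le_right (norm_nonneg _) (Real.one_le_exp ?_)
  have h2 := mul_le_mul_of_nonneg_left hu.2 hτ0
  linarith

/-- The antiderivative grows at most like `exp (σ v / 2)`, which the weight `exp (-σ v)` beats.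
Positivity of `σ` matters, since an antiderivative need not decay. -/
theorem MemLaplaceTwo.antideriv {F : ℝ → ℂ} (h : ∀ σ, 0 < σ → MemLaplaceTwo F σ) {σ : ℝ}
    (hσ : 0 < σ) : MemLaplaceTwo (antiderivFromZero F) σ := by
  set K := ∫ u in Ioi (0 : ℝ), ‖F u‖ * Real.exp (-(σ / 2 * u))
  refine MemLp.of_le_mul (c := K) (memLp_exp_Ioi (half_pos hσ))
    (((h 1 one_pos).continuousOn_antideriv.aestronglyMeasurable measurableSet_Ioi).mul
      (by fun_prop)) ?_
  filter_upwards [ae_restrict_mem measurableSet_Ioi] with v hv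
  have h1 := (h (σ / 3) (by linarith)).norm_antideriv_le (τ := σ / 2) (by linarith) (by linarith) hv
  rw [norm_mul]
  simp only [Complex.norm_real, Real.norm_eq_abs, Real.abs_exp]
  calc _ ≤ K * Real.exp (σ / 2 * v) * Real.exp (-(σ * v)) := by gcongr
    _ = _ := by rw [mul_assoc, ← Real.exp_add]; ring_nf

/-- The antiderivative is the convolution of `F` with the constant `1` on the half-line, whose
Laplace transform is `1 / s`. The weights `exp (-s v)` are put into both factors beforehand, so that
the convolution is one of integrable functions. -/
theorem laplaceTransform_antideriv {F : ℝ → ℂ} (h : ∀ σ, 0 < σ → MemLaplaceTwo F σ) {s : ℂ}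
    (hs : 0 < s.re) : s * laplaceTransform (antiderivFromZero F) s = laplaceTransform F s := by
  have hs0 : s ≠ 0 := fun h0 => by rw [h0] at hs; simp at hs
  set f : ℝ → ℂ := (Ioi (0 : ℝ)).indicator fun v => F v * Complex.exp (-(s * v))
  set g : ℝ → ℂ := (Ioi (0 : ℝ)).indicator fun v => Complex.exp (-(s * v))
  have hf : Integrable f := (integrable_indicator_iff measurableSet_Ioi).mpr
    ((h (s.re / 2) (by linarith)).integrable_cexp (by linarith))
  have hg' : IntegrableOn (fun v : ℝ => Complex.exp (-(s * v))) (Ioi 0) := by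
    have := integrableOn_exp_mul_complex_Ioi (a := -s) (by simpa using hs) 0
    simpa only [neg_mul] using this
  have hg : Integrable g := (integrable_indicator_iff measurableSet_Ioi).mpr hg'
  have hconv := integral_convolution (ContinuousLinearMap.mul ℂ ℂ) hf hg
  have e1 : ∫ v, f v = laplaceTransform F s := integral_indicator measurableSet_Ioi
  have e2 : ∫ v, g v = 1 / s := by
    rw [integral_indicator measurableSet_Ioi]
    have := integral_exp_mul_complex_Ioi (a := -s) (by simpa using hs) 0
    simp only [neg_mul] at this
    rw [this]
    simp
  have e3 : ∫ v, (convolution f g (ContinuousLinearMap.mul ℂ ℂ) volume) v =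
      laplaceTransform (antiderivFromZero F) s := by
    rw [laplaceTransform, ← integral_indicator measurableSet_Ioi]
    refine integral_congr_ae (Eventually.of_forall fun v => ?_)
    simp only [convolution, ContinuousLinearMap.mul_apply']
    by_cases hv : 0 < v
    · rw [indicator_of_mem (mem_Ioi.mpr hv), antiderivFromZero, intervalIntegral.integral_of_le hv.le,
        integral_Ioc_eq_integral_Ioo, ← integral_mul_const, ← integral_indicator measurableSet_Ioo]
      refine integral_congr_ae (Eventually.of_forall fun t => ?_)
      simp only [f, g, indicator_apply, mem_Ioi, mem_Ioo, sub_pos]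
      by_cases ht : 0 < t
      · by_cases htv : t < v
        · simp only [ht, htv, and_self, if_true]
          rw [mul_assoc, ← Complex.exp_add]
          push_cast
          ring_nf
        · simp [htv]
      · simp [ht]
    · rw [indicator_of_notMem (by simpa using hv)]
      refine integral_eq_zero_of_ae (Eventually.of_forall fun t => ?_)
      simp only [f, g, Pi.zero_apply, mul_eq_zero]
      by_cases ht : 0 < t
      · right; exact indicator_of_notMem (by simp; linarith) _
      · left; exact indicator_of_notMem (by simpa using ht) _
  rw [e1, e2, e3] at hconv
  rw [hconv, ContinuousLinearMap.mul_apply']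
  field_simp

theorem contDiffOn_antideriv {F : ℝ → ℂ} {σ : ℝ} (h : MemLaplaceTwo F σ) {n : ℕ}
    (hF : ContDiffOn ℝ n F (Ioi 0)) :
    ContDiffOn ℝ ((n + 1 : ℕ) : WithTop ℕ∞) (antiderivFromZero F) (Ioi 0) := by
  have hd : ∀ v ∈ Ioi (0 : ℝ), HasDerivAt (antiderivFromZero F) (F v) v := fun v hv => by
    have hv' : (0 : ℝ) < v := hv
    refine intervalIntegral.integral_hasDerivAt_right
      ((intervalIntegrable_iff_integrableOn_Ioc_of_le hv'.le).mpr (h.integrableOn_Ioc le_rfl)) ?_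
      (hF.continuousOn.continuousAt (Ioi_mem_nhds hv))
    exact hF.continuousOn.stronglyMeasurableAtFilter isOpen_Ioi v hv
  push_cast
  rw [contDiffOn_succ_iff_deriv_of_isOpen isOpen_Ioi]
  refine ⟨fun v hv => (hd v hv).differentiableAt.differentiableWithinAt, by simp, ?_⟩
  exact hF.congr fun v hv => (hd v hv).deriv

theorem iterate_antideriv {G : ℝ → ℂ} (h : ∀ σ, 0 < σ → MemLaplaceTwo G σ) (p : ℕ) :
    (∀ σ, 0 < σ → MemLaplaceTwo (antiderivFromZero^[p] G) σ) ∧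
    (∀ s : ℂ, 0 < s.re → s ^ p * laplaceTransform (antiderivFromZero^[p] G) s =
      laplaceTransform G s) := by
  induction p with
  | zero => exact ⟨h, fun s _ => by simp⟩
  | succ p ih =>
    rw [Function.iterate_succ_apply']
    refine ⟨fun σ hσ => MemLaplaceTwo.antideriv ih.1 hσ, fun s hs => ?_⟩
    rw [pow_succ, mul_assoc, laplaceTransform_antideriv ih.1 hs, ih.2 s hs]

/-- The first integration of `G` yields only continuity; each later one gains a derivative. Hence `p
+ 1` integrations for class `C^p`. -/
theorem contDiffOn_iterate_antideriv {G : ℝ → ℂ} (h : ∀ σ, 0 < σ → MemLaplaceTwo G σ) (p : ℕ) :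
    ContDiffOn ℝ (p : WithTop ℕ∞) (antiderivFromZero^[p + 1] G) (Ioi 0) := by
  induction p with
  | zero =>
    simpa using (h 1 one_pos).continuousOn_antideriv
  | succ p ih =>
    rw [Function.iterate_succ_apply']
    exact contDiffOn_antideriv ((iterate_antideriv h (p + 1)).1 1 one_pos) ih

/-! ### Cauchy transforms and the Plemelj formula -/

noncomputable def cauchyTransform (φ : ℝ → ℂ) (ζ : ℂ) : ℂ := ∫ x : ℝ, φ x / (ζ - x)

theorem differentiableOn_cauchyTransform {φ : ℝ → ℂ} (hφ : Integrable φ) {K : Set ℝ}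
    (hK : IsCompact K) (h0 : ∀ x ∉ K, φ x = 0) :
    DifferentiableOn ℂ (cauchyTransform φ) (((↑) : ℝ → ℂ) '' K)ᶜ := by
  intro ζ hζ
  have hcl : IsClosed (((↑) : ℝ → ℂ) '' K) := (hK.image Complex.continuous_ofReal).isClosed
  obtain ⟨d, hd, hball⟩ := Metric.isOpen_iff.mp hcl.isOpen_compl ζ hζ
  have hdist : ∀ z ∈ Metric.ball ζ (d / 2), ∀ x ∈ K, d / 2 ≤ ‖z - x‖ := fun z hz x hx => by
    by_contra! hlt
    rw [Metric.mem_ball] at hz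
    refine absurd (mem_image_of_mem _ hx) (hball (Metric.mem_ball.mpr ?_))
    calc dist (x : ℂ) ζ ≤ dist (x : ℂ) z + dist z ζ := dist_triangle _ _ _
      _ < d / 2 + d / 2 := by
        refine add_lt_add ?_ hz
        rwa [dist_comm, dist_eq_norm]
      _ = d := by ring
  have hmeas : ∀ z : ℂ, AEStronglyMeasurable (fun x : ℝ => φ x / (z - x)) volume := fun z => by
    refine hφ.1.div₀ ?_
    exact (by fun_prop : Continuous fun x : ℝ => z - (x : ℂ)).aestronglyMeasurable
  have hmul : ∀ (z : ℂ) (x : ℝ) (c : ℝ), (x ∈ K → ‖(z - x)‖⁻¹ ≤ c) →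
      ‖φ x‖ * ‖(z - x)‖⁻¹ ≤ c * ‖φ x‖ := fun z x c h => by
    by_cases hx : x ∈ K
    · rw [mul_comm]; gcongr; exact h hx
    · simp [h0 x hx]
  refine DifferentiableAt.differentiableWithinAt ?_
  refine (hasDerivAt_integral_of_dominated_loc_of_deriv_le (s := Metric.ball ζ (d / 2))
    (F := fun z x => φ x / (z - x)) (F' := fun z x => -φ x / (z - x) ^ 2)
    (bound := fun x => (d / 2)⁻¹ * ((d / 2)⁻¹ * ‖φ x‖))
    (Metric.ball_mem_nhds ζ (by positivity)) (Eventually.of_forall hmeas) ?_ ?_ ?_ ?_ ?_).2.differentiableAt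
  · refine (hφ.norm.const_mul (d / 2)⁻¹).mono' (hmeas ζ) (Eventually.of_forall fun x => ?_)
    rw [norm_div, div_eq_mul_inv]
    refine hmul _ _ _ fun hx => ?_
    exact inv_anti₀ (by positivity) (hdist ζ (Metric.mem_ball_self (by positivity)) x hx)
  · refine hφ.1.neg.div₀ ?_
    exact (by fun_prop : Continuous fun x : ℝ => (ζ - (x : ℂ)) ^ 2).aestronglyMeasurable
  · refine Eventually.of_forall fun x z hz => ?_
    rw [norm_div, norm_neg, norm_pow]
    by_cases hx : x ∈ K
    · have h1 := hdist z hz x hx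
      have hpos : 0 < ‖z - x‖ := lt_of_lt_of_le (by positivity) h1
      rw [div_le_iff₀ (by positivity)]
      have h2 : 1 ≤ (d / 2)⁻¹ * ‖z - x‖ := by
        rw [inv_mul_eq_div, le_div_iff₀ (by positivity)]; simpa using h1
      have h3 : 1 ≤ ((d / 2)⁻¹ * ‖z - x‖) ^ 2 := one_le_pow₀ h2
      calc ‖φ x‖ ≤ ‖φ x‖ * ((d / 2)⁻¹ * ‖z - x‖) ^ 2 := le_mul_of_one_le_right (norm_nonneg _) h3
        _ = _ := by ring
    · simp [h0 x hx]
  · exact (hφ.norm.const_mul _).const_mul _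
  · refine Eventually.of_forall fun x z hz => ?_
    by_cases hx : x ∈ K
    · have hne : z - x ≠ 0 := fun h => by
        have h1 := hdist z hz x hx
        rw [h, norm_zero] at h1; linarith
      have h1 : HasDerivAt (fun z : ℂ => z - x) 1 z := (hasDerivAt_id z).sub_const _
      have h2 := (hasDerivAt_const z (φ x)).fun_div h1 hne
      simpa using h2
    · simp only [h0 x hx, zero_div, neg_zero]
      exact hasDerivAt_const z 0

/-- The interval is symmetric, so adding the integrand at `t` and at `-t` leaves `-2 i ε / (ε² +
t²)`. As `ε → 0` from above or below the value tends to `∓ π i`, the source of the jump. -/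
theorem integral_inv_I_mul_sub {δ ε : ℝ} (hε : ε ≠ 0) :
    ∫ t in (-δ)..δ, (1 : ℂ) / ((ε : ℂ) * Complex.I - t) =
      -Complex.I * (2 * Real.arctan (δ / ε) : ℝ) := by
  have hne : ∀ t : ℝ, (ε : ℂ) * Complex.I - t ≠ 0 := fun t h => by
    have := congrArg Complex.im h
    simp at this; exact hε this
  have hc : ∀ g : ℝ → ℂ, Continuous g → (∀ t, g t ≠ 0) →
      IntervalIntegrable (fun t => 1 / g t) volume (-δ) δ := fun g hg h =>
    (continuous_const.div hg h).intervalIntegrable _ _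
  have hne' : ∀ t : ℝ, (ε : ℂ) * Complex.I + t ≠ 0 := fun t h => by
    have := congrArg Complex.im h
    simp at this; exact hε this
  have h1 : ∫ t in (-δ)..δ, (1 : ℂ) / ((ε : ℂ) * Complex.I - t) =
      ∫ t in (-δ)..δ, (1 : ℂ) / ((ε : ℂ) * Complex.I + t) := by
    have := intervalIntegral.integral_comp_neg (a := -δ) (b := δ)
      (fun t : ℝ => (1 : ℂ) / ((ε : ℂ) * Complex.I - t))
    simp only [neg_neg] at this
    rw [← this]
    simp
  have h2 : ∫ t in (-δ)..δ, ((1 : ℂ) / ((ε : ℂ) * Complex.I - t) + 1 / ((ε : ℂ) * Complex.I + t)) =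
      ∫ t in (-δ)..δ, (-2 * Complex.I) * ((1 / (1 + (t / ε) ^ 2) * (1 / ε) : ℝ) : ℂ) := by
    refine intervalIntegral.integral_congr fun t _ => ?_
    have h3 : (1 : ℝ) + (t / ε) ^ 2 ≠ 0 := by positivity
    have h3' : (1 : ℂ) + ((t : ℂ) / ε) ^ 2 ≠ 0 := by exact_mod_cast h3
    have hε' : (ε : ℂ) ≠ 0 := by exact_mod_cast hε
    have h4 : (ε : ℂ) ^ 2 + t ^ 2 ≠ 0 := by
      have : (ε : ℝ) ^ 2 + t ^ 2 ≠ 0 := by positivity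
      exact_mod_cast this
    rw [div_add_div _ _ (hne t) (hne' t)]
    have h5 : ((ε : ℂ) * Complex.I - t) * ((ε : ℂ) * Complex.I + t) = -((ε : ℂ) ^ 2 + t ^ 2) := by
      ring_nf; rw [Complex.I_sq]; ring
    rw [h5]
    push_cast
    have h6 : (1 : ℂ) / (1 + ((t : ℂ) / ε) ^ 2) * (1 / ε) = ε / (ε ^ 2 + t ^ 2) := by
      field_simp
    rw [h6]
    field_simp
    ring
  have h3 : ∫ t in (-δ)..δ, (1 / (1 + (t / ε) ^ 2) * (1 / ε) : ℝ) =
      Real.arctan (δ / ε) - Real.arctan (-δ / ε) := by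
    refine intervalIntegral.integral_eq_sub_of_hasDerivAt (f := fun t => Real.arctan (t / ε))
      (fun t _ => ((hasDerivAt_id t).div_const ε).arctan) ?_
    refine Continuous.intervalIntegrable ?_ _ _
    refine (continuous_const.div (by fun_prop) fun t => ?_).mul continuous_const
    positivity
  rw [intervalIntegral.integral_add (hc _ (by fun_prop) hne) (hc _ (by fun_prop) hne'), ← h1,
    intervalIntegral.integral_const_mul, intervalIntegral.integral_ofReal, h3, neg_div,
    Real.arctan_neg, ← two_mul] at h2
  have h4 : (2 : ℂ) ≠ 0 := two_ne_zero
  rw [mul_assoc] at h2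
  have h5 : (∫ t in (-δ)..δ, (1 : ℂ) / ((ε : ℂ) * Complex.I - t)) * 2 =
      (-Complex.I * (2 * Real.arctan (δ / ε) : ℝ)) * 2 := by
    rw [mul_comm, h2]; push_cast; ring
  exact mul_right_cancel₀ h4 h5

theorem intervalIntegrable_abs_rpow_neg_half (δ : ℝ) :
    IntervalIntegrable (fun t : ℝ => |t| ^ (-(1 / 2) : ℝ)) volume (-δ) δ := by
  have h : ∀ δ : ℝ, 0 ≤ δ → IntervalIntegrable (fun t : ℝ => |t| ^ (-(1 / 2) : ℝ)) volume 0 δ :=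
    fun δ hδ => by
    refine (intervalIntegral.intervalIntegrable_rpow' (by norm_num : (-1 : ℝ) < -(1 / 2))).congr
      fun t ht => ?_
    rw [uIoc_of_le hδ] at ht
    rw [abs_of_pos ht.1]
  have h' : ∀ δ : ℝ, IntervalIntegrable (fun t : ℝ => |t| ^ (-(1 / 2) : ℝ)) volume 0 δ := fun δ => by
    rcases le_total 0 δ with hδ | hδ
    · exact h δ hδ
    · have := (IntervalIntegrable.iff_comp_neg (by simp)).mp (h (-δ) (by linarith))
      simpa using this
  exact (h' (-δ)).symm.trans (h' δ)

/-- The **Plemelj formula** for the Cauchy transform of a locally Hölder function. -/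
theorem tendsto_cauchyTransform {φ : ℝ → ℂ} (hφ : Integrable φ) {x₀ δ C : ℝ} (hδ : 0 < δ)
    (hH : ∀ x ∈ Ioo (x₀ - 2 * δ) (x₀ + 2 * δ), ∀ y ∈ Ioo (x₀ - 2 * δ) (x₀ + 2 * δ),
      ‖φ x - φ y‖ ≤ C * √|x - y|) :
    ∃ P : ℂ,
      Tendsto (cauchyTransform φ) (𝓝[{ζ : ℂ | 0 < ζ.im}] (x₀ : ℂ))
        (𝓝 (P - Real.pi * Complex.I * φ x₀)) ∧
      Tendsto (cauchyTransform φ) (𝓝[{ζ : ℂ | ζ.im < 0}] (x₀ : ℂ))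
        (𝓝 (P + Real.pi * Complex.I * φ x₀)) := by
  have hcont : ∀ x ∈ Ioo (x₀ - 2 * δ) (x₀ + 2 * δ), ContinuousAt φ x := fun x hx => by
    rw [ContinuousAt, tendsto_iff_norm_sub_tendsto_zero]
    have h1 : Tendsto (fun y : ℝ => C * √|y - x|) (𝓝 x) (𝓝 0) := by
      have : Continuous fun y : ℝ => C * √|y - x| := by fun_prop
      simpa using this.tendsto x
    refine squeeze_zero' (Eventually.of_forall fun y => norm_nonneg _) ?_ h1
    filter_upwards [isOpen_Ioo.mem_nhds hx] with y hy
    exact hH y hy x hx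
  have hx₀ : x₀ ∈ Ioo (x₀ - 2 * δ) (x₀ + 2 * δ) := ⟨by linarith, by linarith⟩
  -- The integral is cut at distance `δ` from the moving point `Re ζ`. Near it, the constant `φ (Re
  -- ζ)` is subtracted and contributes an explicit arctangent; only that term feels the side of
  -- approach.
  set near : ℂ → ℂ := fun ζ => ∫ t in (-δ)..δ, (φ (ζ.re + t) - φ ζ.re) / ((ζ.im : ℂ) * Complex.I - t)
  set far : ℂ → ℂ := fun ζ => ∫ x : ℝ, (Ioc (ζ.re - δ) (ζ.re + δ))ᶜ.indicator (fun x => φ x / (ζ - x)) x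
  have hpt : ∀ (ζ : ℂ) (t : ℝ), ‖(ζ.im : ℂ) * Complex.I - t‖ ≥ |t| := fun ζ t => by
    have := Complex.abs_re_le_norm ((ζ.im : ℂ) * Complex.I - t)
    simpa using this
  have hdecomp : ∀ ζ : ℂ, ζ.im ≠ 0 → cauchyTransform φ ζ = far ζ + (near ζ +
      φ ζ.re * (-Complex.I * (2 * Real.arctan (δ / ζ.im) : ℝ))) := by
    intro ζ hζ
    have hne : ∀ x : ℝ, ζ - x ≠ 0 := fun x h => by
      have := congrArg Complex.im h
      simp at this; exact hζ this
    have hint : Integrable fun x : ℝ => φ x / (ζ - x) := by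
      simp only [div_eq_mul_inv]
      refine hφ.mul_bdd (c := |ζ.im|⁻¹) ?_ (Eventually.of_forall fun x => ?_)
      · exact (Continuous.inv₀ (by fun_prop) hne).aestronglyMeasurable
      · rw [norm_inv]
        refine inv_anti₀ (abs_pos.mpr hζ) ?_
        have := Complex.abs_im_le_norm (ζ - x)
        simpa using this
    rw [cauchyTransform, ← integral_add_compl (measurableSet_Ioc (a := ζ.re - δ) (b := ζ.re + δ)) hint,
      add_comm]
    simp only [far]
    rw [integral_indicator measurableSet_Ioc.compl]
    congr 1
    rw [← intervalIntegral.integral_of_le (by linarith)]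
    have h1 := intervalIntegral.integral_comp_add_left (fun x : ℝ => φ x / (ζ - x)) (a := -δ) (b := δ) ζ.re
    rw [← sub_eq_add_neg] at h1
    rw [← h1, ← integral_inv_I_mul_sub hζ, ← intervalIntegral.integral_const_mul]
    have e : ∀ t : ℝ, ζ - ((ζ.re + t : ℝ) : ℂ) = (ζ.im : ℂ) * Complex.I - t := fun t => by
      apply Complex.ext <;> simp
    have hne' : ∀ t : ℝ, (ζ.im : ℂ) * Complex.I - t ≠ 0 := fun t => by rw [← e]; exact hne _
    have hi1 : IntervalIntegrable (fun t : ℝ => φ (ζ.re + t) / ((ζ.im : ℂ) * Complex.I - t)) volume (-δ) δ := by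
      have := (hint.comp_add_left ζ.re).intervalIntegrable (a := -δ) (b := δ)
      simpa only [e] using this
    have hi2 : IntervalIntegrable (fun t : ℝ => φ ζ.re * (1 / ((ζ.im : ℂ) * Complex.I - t))) volume (-δ) δ := by
      refine Continuous.intervalIntegrable ?_ _ _
      exact continuous_const.mul (continuous_const.div (by fun_prop) hne')
    have hi3 : IntervalIntegrable (fun t : ℝ => (φ (ζ.re + t) - φ ζ.re) / ((ζ.im : ℂ) * Complex.I - t))
        volume (-δ) δ := by
      refine (hi1.sub hi2).congr fun t _ => ?_
      ring
    simp only [near]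
    rw [← intervalIntegral.integral_add hi3 hi2]
    refine intervalIntegral.integral_congr fun t _ => ?_
    simp only [e]
    ring
  have hre : Tendsto Complex.re (𝓝 (x₀ : ℂ)) (𝓝 x₀) := by
    simpa using Complex.continuous_re.tendsto (x₀ : ℂ)
  have him : Tendsto Complex.im (𝓝 (x₀ : ℂ)) (𝓝 0) := by
    simpa using Complex.continuous_im.tendsto (x₀ : ℂ)
  have hreδ : ∀ᶠ ζ : ℂ in 𝓝 (x₀ : ℂ), |ζ.re - x₀| < δ := by
    have h1 : Tendsto (fun ζ : ℂ => |ζ.re - x₀|) (𝓝 (x₀ : ℂ)) (𝓝 0) := by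
      have := (hre.sub_const x₀).abs
      simpa using this
    exact h1.eventually (gt_mem_nhds hδ)
  have hnear : Tendsto near (𝓝 (x₀ : ℂ)) (𝓝 (near x₀)) := by
    -- The Hölder bound `C * √|t|` divided by `|t|` is integrable. The window `2 * δ` in the
    -- hypothesis leaves room for `Re ζ` within `δ` of `x₀` and `|t| ≤ δ`.
    refine intervalIntegral.tendsto_integral_filter_of_dominated_convergence
      (fun t => C * |t| ^ (-(1 / 2) : ℝ)) ?_ ?_
      ((intervalIntegrable_abs_rpow_neg_half δ).const_mul C) ?_
    · refine Eventually.of_forall fun ζ => AEStronglyMeasurable.div₀ ?_ ?_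
      · exact ((hφ.comp_add_left ζ.re).1.restrict).sub aestronglyMeasurable_const
      · exact (by fun_prop : Continuous fun t : ℝ => (ζ.im : ℂ) * Complex.I - t).aestronglyMeasurable
    · filter_upwards [hreδ] with ζ hζ
      have h0 : ∀ᵐ t : ℝ, t ≠ 0 := Measure.ae_ne volume 0
      filter_upwards [h0] with t ht0 ht
      rw [uIoc_of_le (by linarith)] at ht
      rw [abs_lt] at hζ
      have h1 := hH (ζ.re + t) ⟨by linarith [ht.1], by linarith [ht.2]⟩ ζ.re
        ⟨by linarith, by linarith⟩
      rw [add_sub_cancel_left] at h1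
      have ht' : 0 < |t| := abs_pos.mpr ht0
      rw [norm_div, div_le_iff₀ (ht'.trans_le (hpt ζ t))]
      have hC : 0 ≤ C * |t| ^ (-(1 / 2) : ℝ) := by
        have : 0 ≤ C := by
          by_contra! hneg
          have h2 := (norm_nonneg _).trans h1
          have := mul_neg_of_neg_of_pos hneg (Real.sqrt_pos.mpr ht')
          linarith
        positivity
      refine le_trans ?_ (mul_le_mul_of_nonneg_left (hpt ζ t) hC)
      refine h1.trans (le_of_eq ?_)
      rw [Real.sqrt_eq_rpow, mul_assoc, ← Real.rpow_add_one ht'.ne']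
      norm_num
    · have h0 : ∀ᵐ t : ℝ, t ≠ 0 := Measure.ae_ne volume 0
      filter_upwards [h0] with t ht0 ht
      rw [uIoc_of_le (by linarith)] at ht
      refine Tendsto.div ?_ ?_ ?_
      · refine Tendsto.sub ?_ ?_
        · refine Tendsto.comp (y := 𝓝 (x₀ + t)) ?_ (hre.add_const t)
          simpa using (hcont (x₀ + t) ⟨by linarith [ht.1], by linarith [ht.2]⟩).tendsto
        · simpa [Function.comp_def] using (hcont x₀ hx₀).tendsto.comp hre
      · have : Continuous fun ζ : ℂ => (ζ.im : ℂ) * Complex.I - t := by fun_prop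
        exact this.tendsto _
      · simpa using ht0
  have hfar : Tendsto far (𝓝 (x₀ : ℂ)) (𝓝 (far x₀)) := by
    have hge : ∀ (ζ : ℂ) (x : ℝ), x ∉ Ioc (ζ.re - δ) (ζ.re + δ) → δ ≤ ‖ζ - x‖ := fun ζ x hx => by
      have h1 := Complex.abs_re_le_norm (ζ - x)
      refine le_trans ?_ h1
      simp only [Complex.sub_re, Complex.ofReal_re]
      by_contra! h2
      rw [abs_lt] at h2
      exact hx ⟨by linarith [h2.2], by linarith [h2.1]⟩
    refine tendsto_integral_filter_of_dominated_convergence (fun x => ‖φ x‖ / δ) ?_ ?_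
      (hφ.norm.div_const δ) ?_
    · refine Eventually.of_forall fun ζ => AEStronglyMeasurable.indicator ?_ measurableSet_Ioc.compl
      refine hφ.1.div₀ ?_
      exact (by fun_prop : Continuous fun x : ℝ => ζ - (x : ℂ)).aestronglyMeasurable
    · refine Eventually.of_forall fun ζ => Eventually.of_forall fun x => ?_
      by_cases hx : x ∈ Ioc (ζ.re - δ) (ζ.re + δ)
      · rw [indicator_of_notMem (by simpa using hx), norm_zero]; positivity
      · rw [indicator_of_mem hx, norm_div]
        gcongr
        exact hge ζ x hx
    · filter_upwards [Measure.ae_ne volume (x₀ - δ), Measure.ae_ne volume (x₀ + δ)] with x h1 h2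
      have hl : Tendsto (fun ζ : ℂ => ζ.re - δ) (𝓝 (x₀ : ℂ)) (𝓝 (x₀ - δ)) := hre.sub_const δ
      have hr : Tendsto (fun ζ : ℂ => ζ.re + δ) (𝓝 (x₀ : ℂ)) (𝓝 (x₀ + δ)) := hre.add_const δ
      by_cases hx : x ∈ Ioc (x₀ - δ) (x₀ + δ)
      · have hx1 : x₀ - δ < x := hx.1
        have hx2 : x < x₀ + δ := lt_of_le_of_ne hx.2 h2
        rw [indicator_of_notMem (by simpa using hx)]
        refine tendsto_const_nhds.congr' ?_
        filter_upwards [hl.eventually (gt_mem_nhds hx1), hr.eventually (lt_mem_nhds hx2)] with ζ h3 h4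
        rw [indicator_of_notMem]
        simpa using ⟨h3, h4.le⟩
      · rw [indicator_of_mem (by simpa using hx)]
        have hne : (x₀ : ℂ) - x ≠ 0 := fun h => by
          have h3 := hge x₀ x (by simpa using hx)
          rw [h, norm_zero] at h3; linarith
        have ht : Tendsto (fun ζ : ℂ => φ x / (ζ - x)) (𝓝 (x₀ : ℂ)) (𝓝 (φ x / (x₀ - x))) :=
          tendsto_const_nhds.div (tendsto_id.sub_const _) hne
        refine ht.congr' ?_
        have hor : x < x₀ - δ ∨ x₀ + δ < x := by
          by_contra! h3
          exact hx ⟨lt_of_le_of_ne h3.1 (Ne.symm h1), h3.2⟩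
        rcases hor with h3 | h3
        · filter_upwards [hl.eventually (lt_mem_nhds h3)] with ζ h4
          rw [indicator_of_mem]
          intro h5
          exact absurd h5.1 (by linarith)
        · filter_upwards [hr.eventually (gt_mem_nhds h3)] with ζ h4
          rw [indicator_of_mem]
          intro h5
          exact absurd h5.2 (by linarith)
  have hφre : Tendsto (fun ζ : ℂ => φ ζ.re) (𝓝 (x₀ : ℂ)) (𝓝 (φ x₀)) := (hcont x₀ hx₀).tendsto.comp hre
  -- `L` is the one-sided limit of the arctangent: `π / 2` from above, `-π / 2` from below.
  have key : ∀ (s : Set ℂ) (L : ℝ), (∀ ζ ∈ s, ζ.im ≠ 0) →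
      Tendsto (fun ζ : ℂ => Real.arctan (δ / ζ.im)) (𝓝[s] (x₀ : ℂ)) (𝓝 L) →
      Tendsto (cauchyTransform φ) (𝓝[s] (x₀ : ℂ))
        (𝓝 (far x₀ + near x₀ - 2 * L * Complex.I * φ x₀)) := by
    intro s L hs hL
    have h1 : Tendsto (fun ζ : ℂ => far ζ + (near ζ +
        φ ζ.re * (-Complex.I * (2 * Real.arctan (δ / ζ.im) : ℝ)))) (𝓝[s] (x₀ : ℂ))
        (𝓝 (far x₀ + (near x₀ + φ x₀ * (-Complex.I * (2 * L : ℝ))))) := by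
      refine (hfar.mono_left nhdsWithin_le_nhds).add ((hnear.mono_left nhdsWithin_le_nhds).add
        ((hφre.mono_left nhdsWithin_le_nhds).mul (Tendsto.const_mul _ ?_)))
      exact (Complex.continuous_ofReal.tendsto _).comp (hL.const_mul 2)
    have h2 : far x₀ + (near x₀ + φ x₀ * (-Complex.I * (2 * L : ℝ))) =
        far x₀ + near x₀ - 2 * L * Complex.I * φ x₀ := by push_cast; ring
    rw [h2] at h1
    refine h1.congr' ?_
    filter_upwards [self_mem_nhdsWithin] with ζ hζ
    rw [hdecomp ζ (hs ζ hζ)]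
  refine ⟨far x₀ + near x₀, ?_, ?_⟩
  · have h1 := key {ζ : ℂ | 0 < ζ.im} (Real.pi / 2) (fun ζ hζ => ne_of_gt hζ) (by
      refine (tendsto_nhds_of_tendsto_nhdsWithin Real.tendsto_arctan_atTop).comp ?_
      refine Tendsto.const_mul_atTop hδ (tendsto_inv_nhdsGT_zero.comp ?_)
      exact tendsto_nhdsWithin_iff.mpr ⟨him.mono_left nhdsWithin_le_nhds, self_mem_nhdsWithin⟩)
    convert h1 using 3
    push_cast; ring
  · have h1 := key {ζ : ℂ | ζ.im < 0} (-(Real.pi / 2)) (fun ζ hζ => ne_of_lt hζ) (by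
      refine (tendsto_nhds_of_tendsto_nhdsWithin Real.tendsto_arctan_atBot).comp ?_
      refine Tendsto.const_mul_atBot hδ (tendsto_inv_nhdsLT_zero.comp ?_)
      exact tendsto_nhdsWithin_iff.mpr ⟨him.mono_left nhdsWithin_le_nhds, self_mem_nhdsWithin⟩)
    convert h1 using 2
    push_cast; ring

/-! ### The series, its continuation and the jump -/

/-- The term `i = 0` of the condition alone bounds `(n + 1) ‖n ^ p * a n‖²`, so `‖a n‖` is at most a
constant times `n ^ (-3/2)` because `p ≥ 1`. -/
theorem L2HausdorffCondition.summable_norm {a : ℕ → ℂ} {p : ℕ} (hp : 1 ≤ p)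
    (hf : L2HausdorffCondition (fun n : ℕ => (n : ℂ) ^ p * a n)) : Summable fun n => ‖a n‖ := by
  obtain ⟨M, hM0, hM⟩ := hf
  have hs : Summable fun n : ℕ => √M * (1 / (n : ℝ) ^ (3 / 2 : ℝ)) :=
    (Real.summable_one_div_nat_rpow.mpr (by norm_num)).mul_left _
  refine summable_of_isBigO_nat hs (Asymptotics.IsBigO.of_bound 1 ?_)
  filter_upwards [eventually_ge_atTop 1] with n hn
  have hn1 : (1 : ℝ) ≤ n := by exact_mod_cast hn
  have h1 : ((n : ℝ) + 1) * ‖(n : ℂ) ^ p * a n‖ ^ 2 < M := by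
    refine lt_of_le_of_lt ?_ (hM n)
    gcongr
    have := Finset.single_le_sum (f := fun i => (n.choose i : ℝ) ^ 2 *
      ‖(fwdDiff 1)^[i] (fun n : ℕ => (n : ℂ) ^ p * a n) (n - i)‖ ^ 2) (fun i _ => by positivity)
      (Finset.mem_range.mpr n.succ_pos)
    simpa using this
  rw [norm_norm, one_mul, Real.norm_of_nonneg (by positivity), mul_one_div,
    le_div_iff₀ (by positivity)]
  rw [← Real.sqrt_sq (by positivity : 0 ≤ ‖a n‖ * (n : ℝ) ^ (3 / 2 : ℝ))]
  refine Real.sqrt_le_sqrt (le_trans ?_ h1.le)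
  have h2 : ((n : ℝ) ^ (3 / 2 : ℝ)) ^ 2 = n ^ 3 := by
    rw [← Real.rpow_natCast, ← Real.rpow_mul (by positivity)]
    norm_num
  rw [mul_pow, h2, norm_mul, norm_pow, Complex.norm_natCast, mul_pow]
  have h3 : (n : ℝ) ^ 1 ≤ (n : ℝ) ^ p := pow_le_pow_right₀ hn1 hp
  calc ‖a n‖ ^ 2 * (n : ℝ) ^ 3 = n * (((n : ℝ) ^ 1) ^ 2 * ‖a n‖ ^ 2) := by ring
    _ ≤ ((n : ℝ) + 1) * (((n : ℝ) ^ p) ^ 2 * ‖a n‖ ^ 2) := by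
      gcongr
      linarith

/-- The function `F` in the variable `x = exp (-v)`. -/
noncomputable def logDensity (F : ℝ → ℂ) : ℝ → ℂ :=
  (Ioo (0 : ℝ) 1).indicator fun x => F (-Real.log x)

theorem integrable_logDensity {F : ℝ → ℂ} (h : ∀ σ, 0 < σ → MemLaplaceTwo F σ) :
    Integrable (logDensity F) := by
  rw [logDensity, integrable_indicator_iff measurableSet_Ioo, integrableOn_Ioo_iff_exp_neg]
  refine ((h (1 / 2) (by norm_num)).integrable_exp (τ := 1) (by norm_num)).congr
    (Eventually.of_forall fun v => ?_)
  simp [mul_comm]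

theorem integral_logDensity_mul_pow (F : ℝ → ℂ) (n : ℕ) :
    ∫ x, logDensity F x * (x : ℂ) ^ n = laplaceTransform F (n + 1 : ℕ) := by
  have h1 : ∀ x, logDensity F x * (x : ℂ) ^ n =
      (Ioo (0 : ℝ) 1).indicator (fun x => F (-Real.log x) * (x : ℂ) ^ n) x := fun x => by
    simp only [logDensity, indicator_apply]
    split_ifs <;> simp
  simp_rw [h1]
  rw [integral_indicator measurableSet_Ioo, integral_Ioo_eq_integral_exp_neg, laplaceTransform]
  refine integral_congr_ae (Eventually.of_forall fun v => ?_)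
  simp only [Real.log_exp, neg_neg, Complex.real_smul]
  push_cast
  rw [mul_left_comm, ← Complex.exp_nat_mul, ← Complex.exp_add]
  ring_nf

/-- The factor `n ^ p` forgets `a 0`, so the density accounts only for the terms `n ≥ 1` and the
constant term is added by hand. -/
noncomputable def seriesExtension (a : ℕ → ℂ) (F : ℝ → ℂ) (θ : ℂ) : ℂ :=
  1 / (2 * (Real.pi : ℂ)) * (a 0 + cauchyTransform (logDensity F) (Complex.exp (Complex.I * θ)))

/-- For `Im θ < 0` the point `ζ = exp (iθ)` lies outside the unit disc. There `1 / (ζ - x) = ∑ x ^ n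
/ ζ ^ (n + 1)`, and the `n`-th moment of the density in `x` is `a (n + 1)`. -/
theorem hasSum_seriesExtension {a : ℕ → ℂ} {F : ℝ → ℂ} (h : ∀ σ, 0 < σ → MemLaplaceTwo F σ)
    (ha : ∀ n : ℕ, 0 < n → a n = laplaceTransform F n) {θ : ℂ} (hθ : θ.im < 0) :
    HasSum (fun n : ℕ => 1 / (2 * (Real.pi : ℂ)) * (a n * Complex.exp (-(Complex.I * n * θ))))
      (seriesExtension a F θ) := by
  refine HasSum.mul_left _ ?_
  rw [← hasSum_nat_add_iff' 1]
  simp only [Finset.range_one, Finset.sum_singleton, Nat.cast_zero, mul_zero, zero_mul, neg_zero,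
    Complex.exp_zero, mul_one, add_sub_cancel_left]
  set ζ := Complex.exp (Complex.I * θ) with hζ
  have hζ1 : 1 < ‖ζ‖ := by
    rw [hζ, Complex.norm_exp]; simpa using hθ
  have hζ0 : ζ ≠ 0 := Complex.exp_ne_zero _
  set φ := logDensity F with hφdef
  have hφ : Integrable φ := integrable_logDensity h
  have hφ0 : ∀ x, x ∉ Ioo (0 : ℝ) 1 → φ x = 0 := fun x hx => indicator_of_notMem hx _
  have hterm : ∀ n : ℕ, a (n + 1) * Complex.exp (-(Complex.I * (n + 1 : ℕ) * θ)) =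
      ∫ x : ℝ, φ x * (x : ℂ) ^ n * (ζ ^ (n + 1))⁻¹ := fun n => by
    rw [integral_mul_const, integral_logDensity_mul_pow, ha _ n.succ_pos, hζ, ← Complex.exp_nat_mul,
      ← Complex.exp_neg]
    congr 2
    ring
  simp_rw [hterm]
  have hbd : ∀ (n : ℕ) (x : ℝ), ‖φ x * (x : ℂ) ^ n * (ζ ^ (n + 1))⁻¹‖ ≤ ‖φ x‖ * (‖ζ‖⁻¹) ^ (n + 1) :=
    fun n x => by
    by_cases hx : x ∈ Ioo (0 : ℝ) 1
    · rw [norm_mul, norm_mul, norm_inv, norm_pow, norm_pow, ← inv_pow, Complex.norm_real,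
        Real.norm_of_nonneg hx.1.le]
      gcongr
      exact mul_le_of_le_one_right (norm_nonneg _) (pow_le_one₀ hx.1.le hx.2.le)
    · rw [hφ0 x hx]; simp
  have hint : ∀ n : ℕ, Integrable fun x : ℝ => φ x * (x : ℂ) ^ n * (ζ ^ (n + 1))⁻¹ := fun n => by
    refine (hφ.norm.mul_const ((‖ζ‖⁻¹) ^ (n + 1))).mono' ?_ (Eventually.of_forall (hbd n))
    exact (hφ.1.mul (by fun_prop : Continuous fun x : ℝ => (x : ℂ) ^ n).aestronglyMeasurable).mul_const _
  have hsum : Summable fun n : ℕ => ∫ x : ℝ, ‖φ x * (x : ℂ) ^ n * (ζ ^ (n + 1))⁻¹‖ := by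
    refine Summable.of_nonneg_of_le (fun n => integral_nonneg fun x => norm_nonneg _)
      (fun n => integral_mono (hint n).norm (hφ.norm.mul_const _) (hbd n)) ?_
    simp_rw [integral_mul_const]
    refine Summable.mul_left _ ?_
    exact (summable_nat_add_iff 1).mpr (summable_geometric_of_lt_one (by positivity) (inv_lt_one_of_one_lt₀ hζ1))
  have hS := hasSum_integral_of_summable_integral_norm hint hsum
  convert hS using 1
  rw [cauchyTransform]
  refine integral_congr_ae (Eventually.of_forall fun x => ?_)
  simp only
  by_cases hx : x ∈ Ioo (0 : ℝ) 1
  · have hr : ‖(x : ℂ) / ζ‖ < 1 := by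
      rw [norm_div, Complex.norm_real, Real.norm_of_nonneg hx.1.le,
        div_lt_one (by linarith)]
      linarith [hx.2]
    have hg := (hasSum_geometric_of_norm_lt_one hr).mul_left (φ x / ζ)
    have hne : ζ - x ≠ 0 := fun h0 => by
      rw [sub_eq_zero] at h0
      rw [h0, Complex.norm_real, Real.norm_of_nonneg hx.1.le] at hζ1
      linarith [hx.2]
    have e : φ x / ζ * (1 - x / ζ)⁻¹ = φ x / (ζ - x) := by
      have : (1 : ℂ) - x / ζ = (ζ - x) / ζ := by field_simp
      rw [this]
      field_simp
    rw [e] at hg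
    rw [← hg.tsum_eq]
    refine tsum_congr fun n => ?_
    rw [div_pow, pow_succ]
    field_simp
  · rw [hφ0 x hx]; simp

theorem tendstoUniformlyOn_seriesExtension {a : ℕ → ℂ} {F : ℝ → ℂ}
    (h : ∀ σ, 0 < σ → MemLaplaceTwo F σ)
    (ha : ∀ n : ℕ, 0 < n → a n = laplaceTransform F n) (hs : Summable fun n => ‖a n‖) :
    TendstoUniformlyOn
      (fun (N : ℕ) (θ : ℂ) => 1 / (2 * (Real.pi : ℂ)) *
        ∑ n ∈ Finset.range N, a n * Complex.exp (-(Complex.I * (n : ℂ) * θ)))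
      (seriesExtension a F) atTop lowerHalfPlane := by
  have h1 := tendstoUniformlyOn_tsum_nat (s := lowerHalfPlane)
    (f := fun (n : ℕ) (θ : ℂ) => 1 / (2 * (Real.pi : ℂ)) * (a n * Complex.exp (-(Complex.I * n * θ))))
    (hs.mul_left ‖1 / (2 * (Real.pi : ℂ))‖) (fun n θ hθ => by
      rw [norm_mul, norm_mul]
      gcongr
      refine mul_le_of_le_one_right (norm_nonneg _) ?_
      rw [Complex.norm_exp, Real.exp_le_one_iff]
      have hθ' : θ.im < 0 := hθ
      simp
      exact mul_nonpos_of_nonneg_of_nonpos (Nat.cast_nonneg n) hθ'.le)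
  simp only [← Finset.mul_sum] at h1
  exact h1.congr_right fun θ hθ => (hasSum_seriesExtension h ha hθ).tsum_eq

/-- The Cauchy integral is holomorphic off `[0, 1]`, and `exp (iθ)` lies in `[0, 1]` only if `θ =
2kπ + iv` with `v ≥ 0`. -/
theorem differentiableOn_seriesExtension {a : ℕ → ℂ} {F : ℝ → ℂ}
    (h : ∀ σ, 0 < σ → MemLaplaceTwo F σ) :
    DifferentiableOn ℂ (seriesExtension a F) cutDomain := by
  have h1 := differentiableOn_cauchyTransform (integrable_logDensity h) (isCompact_Icc (a := 0) (b := 1))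
    (fun x hx => indicator_of_notMem (fun h => hx (Ioo_subset_Icc_self h)) _)
  refine DifferentiableOn.const_mul (DifferentiableOn.const_add _ (h1.comp (by fun_prop) ?_)) _
  rintro θ hθ ⟨x, hx, hxθ⟩
  apply hθ
  change (x : ℂ) = Complex.exp (Complex.I * θ) at hxθ
  have hx0 : 0 < x := by
    refine lt_of_le_of_ne hx.1 fun h0 => ?_
    rw [← h0, Complex.ofReal_zero] at hxθ
    exact Complex.exp_ne_zero _ hxθ.symm
  have h2 : Complex.exp (Complex.I * θ) = Complex.exp ((Real.log x : ℝ) : ℂ) := by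
    rw [← hxθ, ← Complex.ofReal_exp, Real.exp_log hx0]
  obtain ⟨k, hk⟩ := Complex.exp_eq_exp_iff_exists_int.mp h2
  have hre := congrArg Complex.re hk
  have him := congrArg Complex.im hk
  simp at hre him
  refine ⟨k, ?_, ?_⟩
  · rw [him]; ring
  · have := Real.log_nonpos hx.1 hx.2
    linarith

theorem cutDomain_of_im_neg : lowerHalfPlane ⊆ cutDomain := by
  rintro θ hθ ⟨k, -, h⟩
  exact absurd h (not_le.mpr hθ)

theorem logDensity_holder {H : ℝ → ℂ} {σ : ℝ} (h : MemLaplaceTwo H σ) {v : ℝ} (hv : 0 < v) :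
    ∃ δ C : ℝ, 0 < δ ∧
      ∀ x ∈ Ioo (Real.exp (-v) - 2 * δ) (Real.exp (-v) + 2 * δ),
      ∀ y ∈ Ioo (Real.exp (-v) - 2 * δ) (Real.exp (-v) + 2 * δ),
        ‖logDensity (antiderivFromZero H) x - logDensity (antiderivFromZero H) y‖ ≤
          C * √|x - y| := by
  set x₀ := Real.exp (-v) with hx₀
  have hx₀0 : 0 < x₀ := Real.exp_pos _
  have hx₀1 : x₀ < 1 := by rw [hx₀]; simpa using hv
  -- The window of radius `2 * δ` stays inside `(x₀ / 2, 1)`, where the logarithm is Lipschitz with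
  -- constant `2 / x₀`.
  set δ := min (x₀ / 4) ((1 - x₀) / 2) with hδ
  have hδ1 : δ ≤ x₀ / 4 := min_le_left _ _
  have hδ2 : δ ≤ (1 - x₀) / 2 := min_le_right _ _
  set A := √(∫ u in Ioi (0 : ℝ), ‖H u * (Real.exp (-(σ * u)) : ℂ)‖ ^ 2)
  set C := Real.exp (|σ| * (-Real.log (x₀ / 2))) * (A * √(2 / x₀)) with hC
  refine ⟨δ, C, lt_min (by linarith) (by linarith), ?_⟩
  have hmem : ∀ x ∈ Ioo (x₀ - 2 * δ) (x₀ + 2 * δ), x₀ / 2 < x ∧ x < 1 := fun x hx =>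
    ⟨by linarith [hx.1], by linarith [hx.2]⟩
  have key : ∀ x ∈ Ioo (x₀ - 2 * δ) (x₀ + 2 * δ), ∀ y ∈ Ioo (x₀ - 2 * δ) (x₀ + 2 * δ), y ≤ x →
      ‖logDensity (antiderivFromZero H) x - logDensity (antiderivFromZero H) y‖ ≤
          C * √|x - y| := by
    intro x hx y hy hyx
    obtain ⟨hx1, hx2⟩ := hmem x hx
    obtain ⟨hy1, hy2⟩ := hmem y hy
    have hx0 : 0 < x := by linarith
    have hy0 : 0 < y := by linarith
    rw [logDensity, indicator_of_mem (mem_Ioo.mpr ⟨hx0, hx2⟩),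
      indicator_of_mem (mem_Ioo.mpr ⟨hy0, hy2⟩), norm_sub_rev]
    have hlog : Real.log y ≤ Real.log x := Real.log_le_log hy0 hyx
    have h1 := h.norm_antideriv_sub_le (w := -Real.log x) (v := -Real.log y)
      (by linarith [Real.log_nonpos hx0.le hx2.le]) (by linarith)
    refine h1.trans ?_
    rw [hC, mul_assoc, mul_assoc]
    have h2 : -Real.log y ≤ -Real.log (x₀ / 2) := by
      have := Real.log_le_log (by linarith) hy1.le
      linarith
    have h3 : -Real.log y - -Real.log x ≤ 2 / x₀ * |x - y| := by
      rw [abs_of_nonneg (by linarith)]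
      have h4 := Real.log_le_sub_one_of_pos (div_pos hx0 hy0)
      rw [Real.log_div hx0.ne' hy0.ne'] at h4
      have h5 : x / y - 1 = (x - y) / y := by field_simp
      have h6 : (x - y) / y ≤ (x - y) / (x₀ / 2) := by
        gcongr
      have h7 : (x - y) / (x₀ / 2) = 2 / x₀ * (x - y) := by field_simp
      linarith
    have h4 : √(-Real.log y - -Real.log x) ≤ √(2 / x₀) * √|x - y| := by
      rw [← Real.sqrt_mul (by positivity)]
      exact Real.sqrt_le_sqrt h3
    gcongr
  intro x hx y hy
  rcases le_total y x with hxy | hxy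
  · exact key x hx y hy hxy
  · rw [norm_sub_rev, abs_sub_comm]
    exact key y hy x hx hxy

theorem tendsto_exp_I_mul (k : ℤ) (v : ℝ) :
    Tendsto (fun θ : ℂ => Complex.exp (Complex.I * θ)) (𝓝 (verticalPoint (2 * (k : ℝ) * Real.pi) v))
      (𝓝 (Real.exp (-v) : ℂ)) := by
  have h1 : Continuous fun θ : ℂ => Complex.exp (Complex.I * θ) := by fun_prop
  convert h1.tendsto (verticalPoint (2 * (k : ℝ) * Real.pi) v) using 2
  have : Complex.I * verticalPoint (2 * (k : ℝ) * Real.pi) v = (-v : ℂ) + k * (2 * Real.pi * Complex.I) := by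
    rw [verticalPoint]
    push_cast
    ring_nf
    rw [Complex.I_sq]; ring
  rw [this, Complex.exp_add, Complex.exp_int_mul_two_pi_mul_I]
  push_cast
  ring

theorem exp_I_mul_im (θ : ℂ) (k : ℤ) :
    (Complex.exp (Complex.I * θ)).im = Real.exp (-θ.im) * Real.sin (θ.re - 2 * (k : ℝ) * Real.pi) := by
  rw [Complex.exp_im]
  have := Real.sin_sub_int_mul_two_pi θ.re k
  rw [show 2 * (k : ℝ) * Real.pi = k * (2 * Real.pi) by ring, this]
  simp

/-- The right side of every cut is mapped by `exp (iθ)` to `Im ζ > 0` and the left side to `Im ζ <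
0`, near the same point `exp (-v)`. The Plemelj values differ by `-2πi F v`, and the factor `i / 2π`
turns this into `F v`. -/
theorem isJumpAcrossCuts_seriesExtension (a : ℕ → ℂ) {H : ℝ → ℂ} {σ : ℝ} (hH : MemLaplaceTwo H σ)
    (h : ∀ σ, 0 < σ → MemLaplaceTwo (antiderivFromZero H) σ) :
    IsJumpAcrossCuts (seriesExtension a (antiderivFromZero H)) (antiderivFromZero H) := by
  intro k v hv
  set F := antiderivFromZero H
  obtain ⟨δ, C, hδ, hHol⟩ := logDensity_holder hH hv
  obtain ⟨P, hP1, hP2⟩ := tendsto_cauchyTransform (integrable_logDensity h) hδ hHol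
  have hval : logDensity F (Real.exp (-v)) = F v := by
    rw [logDensity, indicator_of_mem (mem_Ioo.mpr ⟨Real.exp_pos _, by simpa using hv⟩)]
    simp
  rw [hval] at hP1 hP2
  set θ₀ := verticalPoint (2 * (k : ℝ) * Real.pi) v
  have hre : Tendsto (fun θ : ℂ => θ.re - 2 * (k : ℝ) * Real.pi) (𝓝 θ₀) (𝓝 0) := by
    have := (Complex.continuous_re.tendsto θ₀).sub_const (2 * (k : ℝ) * Real.pi)
    rwa [show θ₀.re = _ from verticalPoint_re _ _, sub_self] at this
  have e1 : Tendsto (fun θ : ℂ => Complex.exp (Complex.I * θ))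
      (𝓝[{θ : ℂ | 2 * (k : ℝ) * Real.pi < θ.re}] θ₀)
      (𝓝[{ζ : ℂ | 0 < ζ.im}] (Real.exp (-v) : ℂ)) := by
    refine tendsto_nhdsWithin_iff.mpr ⟨(tendsto_exp_I_mul k v).mono_left nhdsWithin_le_nhds, ?_⟩
    filter_upwards [self_mem_nhdsWithin,
      nhdsWithin_le_nhds (hre.eventually (gt_mem_nhds Real.pi_pos))] with θ h1 h2
    have h1' : 2 * (k : ℝ) * Real.pi < θ.re := h1
    change 0 < (Complex.exp (Complex.I * θ)).im
    rw [exp_I_mul_im θ k]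
    exact mul_pos (Real.exp_pos _) (Real.sin_pos_of_pos_of_lt_pi (by linarith) h2)
  have e2 : Tendsto (fun θ : ℂ => Complex.exp (Complex.I * θ))
      (𝓝[{θ : ℂ | θ.re < 2 * (k : ℝ) * Real.pi}] θ₀)
      (𝓝[{ζ : ℂ | ζ.im < 0}] (Real.exp (-v) : ℂ)) := by
    refine tendsto_nhdsWithin_iff.mpr ⟨(tendsto_exp_I_mul k v).mono_left nhdsWithin_le_nhds, ?_⟩
    filter_upwards [self_mem_nhdsWithin,
      nhdsWithin_le_nhds (hre.eventually (lt_mem_nhds (neg_lt_zero.mpr Real.pi_pos)))] with θ h1 h2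
    have h1' : θ.re < 2 * (k : ℝ) * Real.pi := h1
    change (Complex.exp (Complex.I * θ)).im < 0
    rw [exp_I_mul_im θ k]
    exact mul_neg_of_pos_of_neg (Real.exp_pos _)
      (Real.sin_neg_of_neg_of_neg_pi_lt (by linarith) h2)
  refine ⟨_, _, ((hP1.comp e1).const_add (a 0)).const_mul (1 / (2 * (Real.pi : ℂ))),
    ((hP2.comp e2).const_add (a 0)).const_mul (1 / (2 * (Real.pi : ℂ))), ?_⟩
  have hpi : (Real.pi : ℂ) ≠ 0 := by exact_mod_cast Real.pi_ne_zero
  field_simp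
  ring_nf
  rw [Complex.I_sq]
  ring

/-! ### Boundary values on vertical lines -/

/-- On the line `Re s = σ` itself the Laplace integral may diverge, and the `L²` Fourier transform
replaces it. Division by `2π` reconciles the two normalisations of frequency. -/
noncomputable def lineTransform {F : ℝ → ℂ} {σ : ℝ} (h : MemLaplaceTwo F σ) (ν : ℝ) : ℂ :=
  (𝓕 (h.memLp_weighted.toLp _) : Lp ℂ 2 (volume : Measure ℝ)) (ν / (2 * Real.pi))

theorem eLpNorm_fourier_comp_div (u : Lp ℂ 2 (volume : Measure ℝ)) :
    eLpNorm (fun ν : ℝ => (𝓕 u : Lp ℂ 2 (volume : Measure ℝ)) (ν / (2 * Real.pi))) 2 volume =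
      ENNReal.ofReal (2 * Real.pi) ^ (1 / 2 : ℝ) * eLpNorm u 2 volume := by
  rw [eLpNorm_two_comp_div, ← Lp.enorm_def, ← Lp.enorm_def, ← ofReal_norm, ← ofReal_norm,
    Lp.norm_fourier_eq]

theorem eLpNorm_lineTransform_sub {F : ℝ → ℂ} {σ τ : ℝ} (h1 : MemLaplaceTwo F σ)
    (h2 : MemLaplaceTwo F τ) :
    eLpNorm (fun ν => lineTransform h1 ν - lineTransform h2 ν) 2 volume =
      ENNReal.ofReal (2 * Real.pi) ^ (1 / 2 : ℝ) *
        eLpNorm (fun v => weighted F σ v - weighted F τ v) 2 volume := by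
  have h3 := eLpNorm_fourier_comp_div (h1.memLp_weighted.toLp _ - h2.memLp_weighted.toLp _)
  rw [← MemLp.toLp_sub, eLpNorm_congr_ae (MemLp.coeFn_toLp _),
    MemLp.toLp_sub h1.memLp_weighted h2.memLp_weighted] at h3
  refine Eq.trans (eLpNorm_congr_ae ?_) h3
  have h4 : (𝓕 (h1.memLp_weighted.toLp _ - h2.memLp_weighted.toLp _) : Lp ℂ 2 (volume : Measure ℝ)) =
      𝓕 (h1.memLp_weighted.toLp _) - 𝓕 (h2.memLp_weighted.toLp _) :=
    map_sub (Lp.fourierTransformₗᵢ ℝ ℂ) _ _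
  rw [h4]
  filter_upwards [ae_comp_div (Lp.coeFn_sub (𝓕 (h1.memLp_weighted.toLp _) : Lp ℂ 2 (volume : Measure ℝ))
    (𝓕 (h2.memLp_weighted.toLp _)))] with ν hν
  rw [hν]
  rfl

theorem eLpNorm_lineTransform {F : ℝ → ℂ} {σ : ℝ} (h : MemLaplaceTwo F σ) :
    eLpNorm (lineTransform h) 2 volume =
      ENNReal.ofReal (2 * Real.pi) ^ (1 / 2 : ℝ) * eLpNorm (weighted F σ) 2 volume := by
  have := eLpNorm_fourier_comp_div (h.memLp_weighted.toLp _)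
  rw [eLpNorm_congr_ae (h.memLp_weighted.coeFn_toLp)] at this
  exact this

theorem memLp_lineTransform {F : ℝ → ℂ} {σ : ℝ} (h : MemLaplaceTwo F σ) :
    MemLp (lineTransform h) 2 volume := by
  refine ⟨?_, ?_⟩
  · have hm : Measurable ((𝓕 (h.memLp_weighted.toLp _) : Lp ℂ 2 (volume : Measure ℝ)) : ℝ → ℂ) :=
      (Lp.stronglyMeasurable _).measurable
    exact (hm.comp (by fun_prop : Measurable fun ν : ℝ => ν / (2 * Real.pi))).aestronglyMeasurable
  · rw [eLpNorm_lineTransform]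
    exact ENNReal.mul_lt_top (ENNReal.rpow_lt_top_of_nonneg (by norm_num) ENNReal.ofReal_ne_top)
      h.memLp_weighted.2

theorem norm_weighted_mono (F : ℝ → ℂ) {σ τ : ℝ} (h : σ ≤ τ) (v : ℝ) :
    ‖weighted F τ v‖ ≤ ‖weighted F σ v‖ := by
  simp only [weighted, indicator_apply]
  split_ifs with hv
  · have hv' : (0 : ℝ) < v := hv
    rw [norm_mul, norm_mul]
    simp only [Complex.norm_real, Real.norm_eq_abs, Real.abs_exp]
    gcongr
  · simp

theorem norm_weighted_sub_le (F : ℝ → ℂ) {σ τ : ℝ} (h : σ ≤ τ) (v : ℝ) :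
    ‖weighted F τ v - weighted F σ v‖ ≤ ‖weighted F σ v‖ := by
  simp only [weighted, indicator_apply]
  split_ifs with hv
  · have hv' : (0 : ℝ) < v := hv
    rw [← mul_sub, norm_mul, norm_mul, ← Complex.ofReal_sub]
    simp only [Complex.norm_real, Real.norm_eq_abs, Real.abs_exp]
    gcongr
    have h1 : Real.exp (-(τ * v)) ≤ Real.exp (-(σ * v)) := by gcongr
    rw [abs_sub_comm, abs_of_nonneg (by linarith)]
    linarith [Real.exp_pos (-(τ * v))]
  · simp

/-- Dominated convergence for the squares, dominated by the weight at `σ`. Plancherel carries this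
to the convergence of Laplace transforms to their boundary values. -/
theorem tendsto_eLpNorm_weighted_sub {F : ℝ → ℂ} {σ : ℝ} (h : MemLaplaceTwo F σ) :
    Tendsto (fun τ => eLpNorm (fun v => weighted F τ v - weighted F σ v) 2 volume)
      (𝓝[>] σ) (𝓝 0) := by
  have h1 : Tendsto (fun τ => ∫⁻ v, ‖weighted F τ v - weighted F σ v‖ₑ ^ (2 : ℝ)) (𝓝[>] σ)
      (𝓝 (∫⁻ _ : ℝ, 0)) := by
    refine tendsto_lintegral_filter_of_dominated_convergence'
      (fun v => ‖weighted F σ v‖ₑ ^ (2 : ℝ)) ?_ ?_ ?_ ?_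
    · filter_upwards [self_mem_nhdsWithin] with τ hτ
      exact (((h.mono (le_of_lt hτ)).memLp_weighted.1.sub h.memLp_weighted.1).enorm).pow_const _
    · filter_upwards [self_mem_nhdsWithin] with τ hτ
      refine Eventually.of_forall fun v => ?_
      gcongr
      exact enorm_le_iff_norm_le.mpr (norm_weighted_sub_le F (le_of_lt hτ) v)
    · have := lintegral_rpow_enorm_lt_top_of_eLpNorm_lt_top (p := 2) (by norm_num) (by norm_num)
        h.memLp_weighted.2
      simpa using this.ne
    · refine Eventually.of_forall fun v => ?_
      have hc : Continuous fun τ => weighted F τ v := by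
        simp only [weighted, indicator_apply]
        split_ifs
        · fun_prop
        · exact continuous_const
      have h2 : Continuous fun τ => ‖weighted F τ v - weighted F σ v‖ₑ ^ (2 : ℝ) :=
        ENNReal.continuous_rpow_const.comp (continuous_enorm.comp (hc.sub continuous_const))
      have h3 := (h2.tendsto σ).mono_left (nhdsWithin_le_nhds (s := Ioi σ))
      simpa using h3
  have h2 := (ENNReal.continuous_rpow_const (y := 1 / 2)).tendsto _ |>.comp h1
  simp only [lintegral_zero] at h2
  rw [ENNReal.zero_rpow_of_pos (by norm_num)] at h2
  refine h2.congr fun τ => ?_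
  rw [eLpNorm_eq_lintegral_rpow_enorm_toReal (by norm_num) (by norm_num)]
  simp

theorem MemLaplaceTwo.line_ae_eq {F : ℝ → ℂ} {σ τ : ℝ} (h : MemLaplaceTwo F σ) (hτ : σ < τ) :
    (fun ν => laplaceTransform F (verticalPoint τ ν)) =ᵐ[volume] lineTransform (h.mono hτ.le) :=
  h.laplace_line_ae_eq hτ

theorem tendsto_eLpNorm_laplace_sub_line {F : ℝ → ℂ} {σ : ℝ} (h : MemLaplaceTwo F σ) :
    Tendsto (fun τ => eLpNorm
      (fun ν => laplaceTransform F (verticalPoint τ ν) - lineTransform h ν) 2 volume)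
      (𝓝[>] σ) (𝓝 0) := by
  have h1 := ENNReal.Tendsto.const_mul (a := ENNReal.ofReal (2 * Real.pi) ^ (1 / 2 : ℝ))
    (tendsto_eLpNorm_weighted_sub h)
    (Or.inr (ENNReal.rpow_ne_top_of_nonneg (by norm_num) ENNReal.ofReal_ne_top))
  rw [mul_zero] at h1
  refine h1.congr' ?_
  filter_upwards [self_mem_nhdsWithin] with τ hτ
  rw [← eLpNorm_lineTransform_sub (h.mono (le_of_lt hτ)) h]
  refine eLpNorm_congr_ae ?_
  filter_upwards [h.line_ae_eq hτ] with ν hν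
  rw [hν]

open Classical in
/-- The Laplace transform on the open half-plane `σ < Re s`, continued by its `L²` boundary values. -/
noncomputable def laplaceExtension {F : ℝ → ℂ} {σ : ℝ} (h : MemLaplaceTwo F σ) (s : ℂ) : ℂ :=
  if σ < s.re then laplaceTransform F s else lineTransform h s.im

theorem laplaceExtension_of_lt {F : ℝ → ℂ} {σ : ℝ} (h : MemLaplaceTwo F σ) {s : ℂ} (hs : σ < s.re) :
    laplaceExtension h s = laplaceTransform F s := if_pos hs

theorem laplaceExtension_verticalPoint {F : ℝ → ℂ} {σ : ℝ} (h : MemLaplaceTwo F σ) (ν : ℝ) :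
    laplaceExtension h (verticalPoint σ ν) = lineTransform h ν := by
  rw [laplaceExtension, if_neg (by rw [verticalPoint_re]; exact lt_irrefl _), verticalPoint_im]

theorem isHardyTwo_laplaceExtension {F : ℝ → ℂ} (h : MemLaplaceTwo F (-(1 / 2))) :
    IsHardyTwo (laplaceExtension h) where
  holomorphic := h.differentiableOn.congr fun s hs => laplaceExtension_of_lt h hs
  bounded := by
    have hfin : ENNReal.ofReal (2 * Real.pi) ^ (1 / 2 : ℝ) *
        eLpNorm (weighted F (-(1 / 2))) 2 volume ≠ ⊤ :=
      ENNReal.mul_ne_top (ENNReal.rpow_ne_top_of_nonneg (by norm_num) ENNReal.ofReal_ne_top)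
        h.memLp_weighted.2.ne
    refine ⟨_, fun σ hσ => le_trans ?_ (ENNReal.coe_toNNReal hfin).ge⟩
    have e : (fun ν : ℝ => laplaceExtension h (verticalPoint σ ν)) =
        fun ν => laplaceTransform F (verticalPoint σ ν) :=
      funext fun ν => laplaceExtension_of_lt h (by rwa [verticalPoint_re])
    rw [e, eLpNorm_congr_ae (h.line_ae_eq hσ), eLpNorm_lineTransform]
    gcongr
    exact eLpNorm_mono fun v => norm_weighted_mono F hσ.le v
  boundary_memLp := by
    simp only [laplaceExtension_verticalPoint]
    exact memLp_lineTransform h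
  boundary_tendsto := by
    refine (tendsto_eLpNorm_laplace_sub_line h).congr' ?_
    filter_upwards [self_mem_nhdsWithin] with τ hτ
    refine congrArg (fun g => eLpNorm g 2 volume) (funext fun ν => ?_)
    rw [laplaceExtension_verticalPoint, laplaceExtension_of_lt h (by rw [verticalPoint_re]; exact hτ)]

/-! ### Uniqueness of the density and of the interpolant -/

theorem eqOn_halfPlane_of_eqOn {g h : ℂ → ℂ} {σ τ : ℝ} (hστ : σ ≤ τ)
    (hg : DifferentiableOn ℂ g {z | σ < z.re}) (hh : DifferentiableOn ℂ h {z | σ < z.re})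
    (he : ∀ z : ℂ, τ < z.re → g z = h z) {z : ℂ} (hz : σ < z.re) : g z = h z := by
  have hpre : IsPreconnected {z : ℂ | σ < z.re} := (convex_halfSpace_re_gt σ).isPreconnected
  have hmem : ((τ + 1 : ℝ) : ℂ) ∈ {z : ℂ | τ < z.re} := by simp
  refine AnalyticOnNhd.eqOn_of_preconnected_of_eventuallyEq (hg.analyticOnNhd (isOpen_re_gt σ))
    (hh.analyticOnNhd (isOpen_re_gt σ)) hpre (lt_of_le_of_lt hστ hmem : ((τ + 1 : ℝ) : ℂ) ∈ _) ?_ hz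
  filter_upwards [(isOpen_re_gt τ).mem_nhds hmem] with w hw
  exact he w hw

/-- Carlson's theorem for Laplace transforms. -/
theorem ae_eq_of_laplaceTransform_natCast_eq {F F' : ℝ → ℂ} {σ : ℝ} (hσ : σ < 1)
    (hF : MemLaplaceTwo F σ) (hF' : MemLaplaceTwo F' σ)
    (he : ∀ n : ℕ, 0 < n → laplaceTransform F n = laplaceTransform F' n) :
    F =ᵐ[volume.restrict (Ioi 0)] F' := by
  have hD : MemLaplaceTwo (fun v => F v - F' v) σ := by
    refine (MemLp.sub hF hF').ae_eq (Eventually.of_forall fun v => ?_)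
    simp [sub_mul]
  have hsub : ∀ s : ℂ, σ < s.re → laplaceTransform (fun v => F v - F' v) s =
      laplaceTransform F s - laplaceTransform F' s := fun s hs => by
    simp only [laplaceTransform]
    rw [← integral_sub (hF.integrable_cexp hs) (hF'.integrable_cexp hs)]
    simp only [sub_mul]
  -- The shift by `1` moves to a half-plane where the transform is bounded, as `σ < 1`; vanishing at
  -- the positive integers is preserved.
  have h1 : ∀ z : ℂ, 0 < z.re → laplaceTransform (fun v => F v - F' v) (z + 1) = 0 := fun z hz => by
    refine eq_zero_of_bounded_of_natCast (g := fun z => laplaceTransform (fun v => F v - F' v) (z + 1))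
      (M := ∫ v in Ioi (0 : ℝ), ‖F v - F' v‖ * Real.exp (-(1 * v))) ?_ ?_ ?_ hz
    · refine hD.differentiableOn.comp (by fun_prop) fun w hw => ?_
      have hw' : 0 < w.re := hw
      change σ < (w + 1).re
      simp; linarith
    · intro w hw
      exact hD.norm_laplaceTransform_le hσ (by simp; linarith)
    · intro n hn
      have := hsub (n + 1) (by simp; have := Nat.cast_nonneg (α := ℝ) n; linarith)
      have h2 := he (n + 1) (Nat.succ_pos n)
      push_cast at h2
      rw [this, h2, sub_self]
  have h2 := hD.ae_eq_zero (τ := 2) (by linarith) fun ν => by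
    have := h1 (verticalPoint 2 ν - 1) (by simp [verticalPoint_re])
    simpa using this
  filter_upwards [h2] with v hv
  exact sub_eq_zero.mp hv

theorem laplaceTransform_congr {F F' : ℝ → ℂ} (h : F =ᵐ[volume.restrict (Ioi 0)] F') (s : ℂ) :
    laplaceTransform F s = laplaceTransform F' s := by
  refine integral_congr_ae ?_
  filter_upwards [h] with v hv
  rw [hv]

theorem MemLaplaceTwo.congr {F F' : ℝ → ℂ} {σ : ℝ} (hF : MemLaplaceTwo F σ)
    (h : F =ᵐ[volume.restrict (Ioi 0)] F') : MemLaplaceTwo F' σ := by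
  refine MemLp.ae_eq ?_ hF
  filter_upwards [h] with v hv
  rw [hv]

/-- Both functions are bounded on `Re s > 0`, so Carlson's theorem applies to their difference
there; the identity theorem covers the rest of the half-plane. -/
theorem IsHardyTwo.eq_laplaceTransform {b : ℂ → ℂ} (hb : IsHardyTwo b) {F : ℝ → ℂ}
    (hF : MemLaplaceTwo F (-(1 / 2))) (he : ∀ n : ℕ, 0 < n → b n = laplaceTransform F n)
    {s : ℂ} (hs : -(1 / 2 : ℝ) < s.re) : b s = laplaceTransform F s := by
  obtain ⟨C, hC⟩ := hb.bounded
  obtain ⟨B, hB⟩ := bounded_right_halfPlane_of_eLpNorm_le hb.holomorphic C hC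
  refine eqOn_halfPlane_of_eqOn (τ := 0) (by norm_num) hb.holomorphic hF.differentiableOn ?_ hs
  intro z hz
  rw [← sub_eq_zero]
  have hsub : {z : ℂ | 0 < z.re} ⊆ {z : ℂ | -(1 / 2 : ℝ) < z.re} := fun w hw => by
    have hw' : 0 < w.re := hw
    change -(1 / 2 : ℝ) < w.re
    linarith
  refine eq_zero_of_bounded_of_natCast (g := fun z => b z - laplaceTransform F z)
    (M := B + ∫ v in Ioi (0 : ℝ), ‖F v‖ * Real.exp (-(0 * v)))
    ((hb.holomorphic.mono hsub).sub (hF.differentiableOn.mono hsub)) ?_ ?_ hz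
  · intro w hw
    exact (norm_sub_le _ _).trans (add_le_add (hB w hw)
      (hF.norm_laplaceTransform_le (by norm_num) hw.le))
  · intro n hn
    rw [he n hn, sub_self]

theorem IsHardyTwo.line_ae_eq {b : ℂ → ℂ} (hb : IsHardyTwo b) {F : ℝ → ℂ}
    (hF : MemLaplaceTwo F (-(1 / 2)))
    (he : ∀ s : ℂ, -(1 / 2 : ℝ) < s.re → b s = laplaceTransform F s) {σ : ℝ} (hσ : -(1 / 2) ≤ σ) :
    (fun ν => b (verticalPoint σ ν)) =ᵐ[volume] lineTransform (hF.mono hσ) := by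
  rcases hσ.eq_or_lt with rfl | hlt
  · have h1 := hb.boundary_tendsto
    have h2 := tendsto_eLpNorm_laplace_sub_line hF
    have h3 := h1.add h2
    rw [add_zero] at h3
    -- On the boundary line the two functions are `L²` limits of the same interior traces, so their
    -- distance is at most a sum tending to `0`.
    have h4 : eLpNorm (fun ν => b (verticalPoint (-(1 / 2)) ν) - lineTransform hF ν) 2 volume = 0 := by
      refine le_antisymm (ge_of_tendsto h3 ?_) zero_le
      filter_upwards [self_mem_nhdsWithin] with τ hτ
      have hτ' : -(1 / 2 : ℝ) < τ := hτ
      have hm : AEStronglyMeasurable (fun ν => b (verticalPoint τ ν)) volume :=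
        (continuous_comp_verticalPoint hb.holomorphic hτ').aestronglyMeasurable
      have e : (fun ν => laplaceTransform F (verticalPoint τ ν) - lineTransform hF ν) =
          fun ν => b (verticalPoint τ ν) - lineTransform hF ν :=
        funext fun ν => by rw [he _ (by rwa [verticalPoint_re])]
      rw [e]
      have h5 := eLpNorm_sub_le (hm.sub (memLp_lineTransform hF).1) (hm.sub hb.boundary_memLp.1)
        (p := 2) one_le_two
      rw [add_comm]
      refine le_trans (le_of_eq ?_) h5
      congr 1
      funext ν
      simp
    have h6 := (eLpNorm_eq_zero_iff (hb.boundary_memLp.1.sub (memLp_lineTransform hF).1)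
      two_ne_zero).mp h4
    filter_upwards [h6] with ν hν
    exact sub_eq_zero.mp hν
  · refine EventuallyEq.trans (Eventually.of_forall fun ν => ?_) (hF.line_ae_eq hlt)
    exact he _ (by rwa [verticalPoint_re])

/-! ### Integrability, inversion and Plancherel on vertical lines -/

/-- The identity holds pointwise in the interior. `L²` convergence to each trace gives almost
everywhere convergence along a subsequence, chosen first for `F` and then refined for `G`. -/
theorem lineTransform_pow_ae_eq {F G : ℝ → ℂ} {σ₀ : ℝ} (hF : MemLaplaceTwo F σ₀)
    (hG : MemLaplaceTwo G σ₀) {p : ℕ}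
    (he : ∀ s : ℂ, σ₀ < s.re → s ^ p * laplaceTransform F s = laplaceTransform G s)
    {σ : ℝ} (hσ : σ₀ ≤ σ) :
    (fun ν => verticalPoint σ ν ^ p * lineTransform (hF.mono hσ) ν) =ᵐ[volume]
      lineTransform (hG.mono hσ) := by
  have hF' := hF.mono hσ
  have hG' := hG.mono hσ
  have hseq : Tendsto (fun n : ℕ => σ + 1 / ((n : ℝ) + 1)) atTop (𝓝[>] σ) := by
    refine tendsto_nhdsWithin_iff.mpr ⟨?_, Eventually.of_forall fun n => ?_⟩
    · simpa using (tendsto_one_div_add_atTop_nhds_zero_nat (𝕜 := ℝ)).const_add σ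
    · have : (0 : ℝ) < 1 / ((n : ℝ) + 1) := by positivity
      change σ < _
      linarith
  have hgt : ∀ n : ℕ, σ < σ + 1 / ((n : ℝ) + 1) := fun n => by
    have : (0 : ℝ) < 1 / ((n : ℝ) + 1) := by positivity
    linarith
  have hmeas : ∀ {K : ℝ → ℂ} (hK : MemLaplaceTwo K σ) (n : ℕ), AEStronglyMeasurable
      (fun ν => laplaceTransform K (verticalPoint (σ + 1 / ((n : ℝ) + 1)) ν)) volume := fun hK n =>
    (continuous_comp_verticalPoint hK.differentiableOn (hgt n)).aestronglyMeasurable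
  have hFm := tendstoInMeasure_of_tendsto_eLpNorm two_ne_zero (hmeas hF') (memLp_lineTransform hF').1
    ((tendsto_eLpNorm_laplace_sub_line hF').comp hseq)
  obtain ⟨ns, hns, hFae⟩ := hFm.exists_seq_tendsto_ae'
  have hGm := tendstoInMeasure_of_tendsto_eLpNorm two_ne_zero (fun k => hmeas hG' (ns k))
    (memLp_lineTransform hG').1 (((tendsto_eLpNorm_laplace_sub_line hG').comp hseq).comp hns)
  obtain ⟨ms, hms, hGae⟩ := hGm.exists_seq_tendsto_ae'
  filter_upwards [hFae, hGae] with ν h1 h2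
  have h3 := h1.comp hms
  have h4 : Tendsto (fun k : ℕ => verticalPoint (σ + 1 / ((ns (ms k) : ℝ) + 1)) ν ^ p) atTop
      (𝓝 (verticalPoint σ ν ^ p)) := by
    have hc : Continuous fun τ : ℝ => verticalPoint τ ν ^ p := by unfold verticalPoint; fun_prop
    exact (hc.tendsto σ).comp ((tendsto_nhds_of_tendsto_nhdsWithin hseq).comp (hns.comp hms))
  refine tendsto_nhds_unique (h4.mul h3) (h2.congr fun k => ?_)
  simp only [Function.comp_apply]
  rw [he _ (by rw [verticalPoint_re]; linarith [hgt (ns (ms k))])]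

/-- `B` is dominated by `(1 + |ν|)⁻¹` times a square integrable function, since `1 + ‖σ + iν‖ ^ p`
is at least `(1 + |ν|) / 2` when `p ≥ 1`; a product of two `L²` functions is integrable. -/
theorem integrable_of_memLp_two_of_pow {B : ℝ → ℂ} {σ : ℝ} {p : ℕ} (hp : 1 ≤ p)
    (h1 : MemLp B 2 volume) (h2 : MemLp (fun ν => verticalPoint σ ν ^ p * B ν) 2 volume) :
    Integrable B := by
  have h3 : MemLp (fun ν : ℝ => ((1 + |ν|)⁻¹ : ℝ)) 2 volume := by
    rw [memLp_two_iff_integrable_sq (by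
      refine (Continuous.inv₀ (by fun_prop) fun ν => ?_).aestronglyMeasurable
      positivity)]
    refine integrable_inv_one_add_sq.mono' ?_ (Eventually.of_forall fun ν => ?_)
    · refine (Continuous.pow (Continuous.inv₀ (by fun_prop) fun ν => ?_) 2).aestronglyMeasurable
      positivity
    · rw [Real.norm_of_nonneg (by positivity), inv_pow]
      refine inv_anti₀ (by positivity) ?_
      nlinarith [abs_nonneg ν, sq_abs ν]
  have h4 : Integrable (fun ν => (2 * (1 + |ν|)⁻¹) * (‖B ν‖ + ‖verticalPoint σ ν ^ p * B ν‖)) :=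
    MemLp.integrable_mul (h3.const_mul 2) (h1.norm.add h2.norm)
  refine h4.mono' h1.1 (Eventually.of_forall fun ν => ?_)
  have hν : |ν| ≤ ‖verticalPoint σ ν‖ := by
    have := Complex.abs_im_le_norm (verticalPoint σ ν)
    rwa [verticalPoint_im] at this
  have h5 : (1 + |ν|) / 2 ≤ 1 + ‖verticalPoint σ ν‖ ^ p := by
    rcases le_total |ν| 1 with h | h
    · have : 0 ≤ ‖verticalPoint σ ν‖ ^ p := by positivity
      linarith
    · have h6 : |ν| ≤ ‖verticalPoint σ ν‖ ^ p :=
        hν.trans (le_self_pow₀ (h.trans hν) (by omega))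
      linarith
  rw [norm_mul, norm_pow]
  have h6 : 0 < 1 + |ν| := by positivity
  have h7 : 1 ≤ (2 * (1 + |ν|)⁻¹) * (1 + ‖verticalPoint σ ν‖ ^ p) := by
    rw [mul_right_comm, ← div_eq_mul_inv, le_div_iff₀ h6]
    linarith
  calc ‖B ν‖ ≤ ((2 * (1 + |ν|)⁻¹) * (1 + ‖verticalPoint σ ν‖ ^ p)) * ‖B ν‖ :=
        le_mul_of_one_le_left (norm_nonneg _) h7
    _ = _ := by ring

theorem integral_comp_div_two_pi (h : ℝ → ℝ) :
    ∫ ν : ℝ, h (ν / (2 * Real.pi)) = 2 * Real.pi * ∫ x, h x := by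
  rw [Measure.integral_comp_div, abs_of_pos (by positivity), smul_eq_mul]

theorem integral_norm_sq_lineTransform {F : ℝ → ℂ} {σ : ℝ} (h : MemLaplaceTwo F σ) :
    ∫ ν, ‖lineTransform h ν‖ ^ 2 =
      2 * Real.pi * ∫ v in Ioi (0 : ℝ), ‖F v * (Real.exp (-(σ * v)) : ℂ)‖ ^ 2 := by
  have h1 := integral_comp_div_two_pi fun x =>
    ‖(𝓕 (h.memLp_weighted.toLp _) : Lp ℂ 2 (volume : Measure ℝ)) x‖ ^ 2
  refine h1.trans ?_
  rw [integral_norm_sq_eq_norm_sq, Lp.norm_fourier_eq, ← integral_norm_sq_eq_norm_sq,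
    ← integral_indicator measurableSet_Ioi]
  congr 1
  refine integral_congr_ae ?_
  filter_upwards [h.memLp_weighted.coeFn_toLp] with v hv
  rw [hv]
  simp only [weighted, indicator_apply]
  split_ifs <;> simp

/-- Fourier inversion gives the bound for almost every `v`; continuity of `F` extends it to every `v
> 0`. -/
theorem norm_le_integral_lineTransform {F : ℝ → ℂ} {σ : ℝ} (h : MemLaplaceTwo F σ)
    (hi : Integrable (lineTransform h)) (hc : ContinuousOn F (Ioi 0)) {v : ℝ} (hv : 0 < v) :
    ‖F v‖ ≤ (1 / (2 * Real.pi) * ∫ ν, ‖lineTransform h ν‖) * Real.exp (σ * v) := by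
  set u : Lp ℂ 2 (volume : Measure ℝ) := h.memLp_weighted.toLp _
  have hi' : Integrable (𝓕 u : Lp ℂ 2 (volume : Measure ℝ)) := by
    have h1 := hi.comp_mul_left' (R := 2 * Real.pi) (by positivity)
    refine h1.congr (Eventually.of_forall fun ξ => ?_)
    simp only [lineTransform]
    rw [mul_div_cancel_left₀ _ (by positivity)]
  have h1 := ae_norm_le_integral_norm_fourier u hi'
  have h2 : ∫ ξ, ‖(𝓕 u : Lp ℂ 2 (volume : Measure ℝ)) ξ‖ =
      1 / (2 * Real.pi) * ∫ ν, ‖lineTransform h ν‖ := by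
    have h3 := integral_comp_div_two_pi fun x => ‖(𝓕 u : Lp ℂ 2 (volume : Measure ℝ)) x‖
    have h4 : ∫ ν, ‖lineTransform h ν‖ = 2 * Real.pi * ∫ x, ‖(𝓕 u : Lp ℂ 2 (volume : Measure ℝ)) x‖ := h3
    rw [h4]
    field_simp
  rw [h2] at h1
  set K := 1 / (2 * Real.pi) * ∫ ν, ‖lineTransform h ν‖
  have h3 : ∀ᵐ x, x ∈ Ioi (0 : ℝ) → ‖F x‖ ≤ K * Real.exp (σ * x) := by
    filter_upwards [h1, h.memLp_weighted.coeFn_toLp] with x hx1 hx2 hx0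
    rw [hx2, weighted, indicator_of_mem hx0, norm_mul, Complex.norm_real, Real.norm_eq_abs,
      Real.abs_exp, Real.exp_neg, ← div_eq_mul_inv, div_le_iff₀ (Real.exp_pos _)] at hx1
    exact hx1
  by_contra! hlt
  -- A set of full measure is dense, so it meets the neighbourhood where the bound would fail.
  have hd := Measure.dense_of_ae h3
  have hca : ContinuousAt F v := hc.continuousAt (Ioi_mem_nhds hv)
  have hev : ∀ᶠ x in 𝓝 v, K * Real.exp (σ * x) < ‖F x‖ :=
    (by fun_prop : Continuous fun x => K * Real.exp (σ * x)).continuousAt.eventually_lt hca.norm hlt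
  obtain ⟨x, hx1, hx2⟩ := mem_closure_iff_nhds.mp (hd v) _ (hev.and (Ioi_mem_nhds hv))
  exact absurd (hx2 hx1.2) (not_le.mpr hx1.1)

/-! ### Proof of the theorem -/

theorem pow_mul_laplaceTransform_eq {a : ℕ → ℂ} {p : ℕ} {F G : ℝ → ℂ}
    (hG : ∀ n : ℕ, (n : ℂ) ^ p * a n = laplaceTransform G n)
    (hFG : ∀ s : ℂ, 0 < s.re → s ^ p * laplaceTransform F s = laplaceTransform G s)
    {n : ℕ} (hn : 0 < n) : a n = laplaceTransform F n := by
  have h1 := hFG n (by simpa using hn)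
  rw [← hG n] at h1
  have hne : (n : ℂ) ^ p ≠ 0 := pow_ne_zero _ (by exact_mod_cast hn.ne')
  exact (mul_left_cancel₀ hne h1).symm

/-- Integration controls `F` only for positive exponents. The density of `a` agrees with `F` almost
everywhere by Carlson's theorem, and this brings the exponent down to `-1/2` and recovers the value
at `n = 0`. -/
theorem L2HausdorffCondition.memLaplaceTwo {a : ℕ → ℂ} (ha : L2HausdorffCondition a) {F : ℝ → ℂ}
    (hF : ∀ σ, 0 < σ → MemLaplaceTwo F σ)
    (hFa : ∀ n : ℕ, 0 < n → a n = laplaceTransform F n) :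
    MemLaplaceTwo F (-(1 / 2)) ∧ ∀ n : ℕ, a n = laplaceTransform F n := by
  obtain ⟨A, hA, hAa⟩ := ha.exists_density
  have hA' : MemLaplaceTwo A (-(1 / 2)) := hA
  have hAe : A =ᵐ[volume.restrict (Ioi 0)] F :=
    ae_eq_of_laplaceTransform_natCast_eq (σ := 1 / 2) (by norm_num) (hA'.mono (by norm_num))
      (hF _ (by norm_num)) fun n hn => by rw [← hFa n hn]; exact (hAa n).symm
  exact ⟨hA'.congr hAe, fun n => by rw [← laplaceTransform_congr hAe]; exact hAa n⟩

theorem theorem1 (a : ℕ → ℂ) (p : ℕ) (hp : 1 ≤ p)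
    (hf : L2HausdorffCondition (fun n : ℕ => (n : ℂ) ^ p * a n)) :
    ∃ (f : ℂ → ℂ) (F : ℝ → ℂ),
      -- the series converges uniformly in the lower half-plane to the analytic function f
      (TendstoUniformlyOn
          (fun (N : ℕ) (θ : ℂ) => 1 / (2 * (Real.pi : ℂ)) *
            ∑ n ∈ Finset.range N, a n * Complex.exp (-(Complex.I * (n : ℂ) * θ)))
          f atTop lowerHalfPlane ∧
        DifferentiableOn ℂ f lowerHalfPlane) ∧
      -- f is holomorphic on the whole cut domain
      DifferentiableOn ℂ f cutDomain ∧
      -- F is the jump of f and it is of class C^(p-1)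
      IsJumpAcrossCuts f F ∧
      ContDiffOn ℝ ((p - 1 : ℕ) : WithTop ℕ∞) F (Ioi 0) ∧
      -- the Carlson interpolant and its relation to the jump
      (L2HausdorffCondition a →
        (∃ b : ℂ → ℂ, IsCarlsonInterpolant a b) ∧
        ∀ b : ℂ → ℂ, IsCarlsonInterpolant a b →
          -- the exponential bound
          (∀ σ : ℝ, -(1 / 2 : ℝ) ≤ σ →
            Integrable (fun ν : ℝ => b (verticalPoint σ ν)) ∧
            ∀ v : ℝ, 0 < v →
              ‖F v‖ ≤ (1 / (2 * Real.pi) * ∫ ν : ℝ, ‖b (verticalPoint σ ν)‖) *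
                Real.exp (σ * v)) ∧
          -- b is the Laplace transform of F
          (∀ σ : ℝ, -(1 / 2 : ℝ) < σ → ∀ ν : ℝ,
            IntegrableOn (fun v : ℝ => F v * Complex.exp (-(verticalPoint σ ν * (v : ℂ))))
              (Ioi 0) ∧
            b (verticalPoint σ ν) =
              ∫ v : ℝ in Ioi 0, F v * Complex.exp (-(verticalPoint σ ν * (v : ℂ)))) ∧
          -- the Plancherel equality
          (∀ σ : ℝ, -(1 / 2 : ℝ) ≤ σ →
            MemLp (fun ν : ℝ => b (verticalPoint σ ν)) 2 volume ∧
            MemLp (fun v : ℝ => F v * (Real.exp (-(σ * v)) : ℂ)) 2 (volume.restrict (Ioi 0)) ∧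
            ∫ ν : ℝ, ‖b (verticalPoint σ ν)‖ ^ 2 =
              2 * Real.pi * ∫ v : ℝ in Ioi 0, ‖F v * (Real.exp (-(σ * v)) : ℂ)‖ ^ 2)) := by
  obtain ⟨G, hG, hGf⟩ := hf.exists_density
  have hG' : MemLaplaceTwo G (-(1 / 2)) := hG
  have hGpos : ∀ σ, 0 < σ → MemLaplaceTwo G σ := fun σ hσ => hG'.mono (by linarith)
  obtain ⟨q, rfl⟩ : ∃ q, p = q + 1 := ⟨p - 1, by omega⟩
  -- The last integration is kept apart: the weighted `L²` bound on `H` gives the Hölder continuity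
  -- of `F` needed for the jump, even when `q = 0` and `F` is only `C⁰`.
  set H := antiderivFromZero^[q] G with hH
  have hHpos := (iterate_antideriv hGpos q).1
  set F := antiderivFromZero H with hFdef
  have hiter : antiderivFromZero^[q + 1] G = F := Function.iterate_succ_apply' _ _ _
  obtain ⟨hFpos, hFG⟩ := iterate_antideriv hGpos (q + 1)
  have hFsmooth := contDiffOn_iterate_antideriv hGpos q
  rw [hiter] at hFpos hFG hFsmooth
  have haF : ∀ n : ℕ, 0 < n → a n = laplaceTransform F n := fun n hn =>
    pow_mul_laplaceTransform_eq hGf hFG hn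
  have hdiff := differentiableOn_seriesExtension (a := a) hFpos
  refine ⟨seriesExtension a F, F,
    ⟨tendstoUniformlyOn_seriesExtension hFpos haF (hf.summable_norm hp),
      hdiff.mono cutDomain_of_im_neg⟩, hdiff,
    isJumpAcrossCuts_seriesExtension a (hHpos 1 one_pos) hFpos, hFsmooth, fun ha => ?_⟩
  obtain ⟨hF, haF0⟩ := ha.memLaplaceTwo hFpos haF
  -- Now that both transforms are holomorphic for `Re s > -1/2`, the identity theorem extends the
  -- relation from `Re s > 0`.
  have hFG' : ∀ s : ℂ, -(1 / 2 : ℝ) < s.re →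
      s ^ (q + 1) * laplaceTransform F s = laplaceTransform G s := fun s hs =>
    eqOn_halfPlane_of_eqOn (τ := 0) (by norm_num)
      ((differentiableOn_id.pow _).mul hF.differentiableOn) hG'.differentiableOn hFG hs
  refine ⟨⟨laplaceExtension hF, isHardyTwo_laplaceExtension hF, fun n => ?_⟩, fun b hb => ?_⟩
  · rw [laplaceExtension_of_lt hF, haF0 n]
    have := Nat.cast_nonneg (α := ℝ) n
    simp only [Complex.natCast_re]
    linarith
  have hbF : ∀ s : ℂ, -(1 / 2 : ℝ) < s.re → b s = laplaceTransform F s := fun s hs =>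
    hb.hardy.eq_laplaceTransform hF (fun n _ => by rw [hb.interpolates n, haF0 n]) hs
  have hline : ∀ {σ : ℝ} (hσ : -(1 / 2 : ℝ) ≤ σ),
      (fun ν => b (verticalPoint σ ν)) =ᵐ[volume] lineTransform (hF.mono hσ) := fun hσ =>
    hb.hardy.line_ae_eq hF hbF hσ
  -- The trace of `s ^ p * LF` is that of `LG`, hence square integrable, down to the boundary line.
  have hint : ∀ {σ : ℝ} (hσ : -(1 / 2 : ℝ) ≤ σ), Integrable (lineTransform (hF.mono hσ)) := fun hσ =>
    integrable_of_memLp_two_of_pow hp (memLp_lineTransform _)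
      ((memLp_lineTransform (hG'.mono hσ)).ae_eq (lineTransform_pow_ae_eq hF hG' hFG' hσ).symm)
  refine ⟨fun σ hσ => ⟨(hint hσ).congr (hline hσ).symm, fun v hv => ?_⟩, fun σ hσ ν => ⟨?_, ?_⟩,
    fun σ hσ => ⟨(memLp_lineTransform (hF.mono hσ)).ae_eq (hline hσ).symm, hF.mono hσ, ?_⟩⟩
  · have h1 := norm_le_integral_lineTransform (hF.mono hσ) (hint hσ) hFsmooth.continuousOn hv
    have h2 : ∫ ν, ‖b (verticalPoint σ ν)‖ = ∫ ν, ‖lineTransform (hF.mono hσ) ν‖ := by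
      refine integral_congr_ae ?_
      filter_upwards [hline hσ] with ν hν
      rw [hν]
    rwa [h2]
  · exact hF.integrable_cexp (by rwa [verticalPoint_re])
  · exact hbF _ (by rwa [verticalPoint_re])
  · rw [← integral_norm_sq_lineTransform (hF.mono hσ)]
    refine integral_congr_ae ?_
    filter_upwards [hline hσ] with ν hν
    rw [hν]
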